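/- **Setting (Statix).** Fix sets of term constructors, edge labels and predicate symbols, and infinite sets of variables, scopes and holes. Terms are $t::=x\mid f(t^*)\mid l\mid s$ (variable, constructor application, label, scope). Set terms are set variables $z$ or finite disjoint unions $\zeta$ of singletons of terms. Constraints are $$C::=\mathsf{emp}\mid\mathsf{false}\mid C*C\mid\exists x.C\mid\mathsf{single}(t,\underline t)\mid\forall x\in\underline t.\,C\mid\nabla t\mapsto t\mid t\xrightarrow{l}t\mid\mathsf{query}^o\,t\;r\;(\lambda y.E)\;\mathsf{as}\;z.\,C\mid E\mid P(t^*),$$ $$E::=t=t\mid\mathsf{dataOf}(t,t)\mid E*E\mid\exists x.E,$$ where $r$ is a regular expression over labels and $o$ a partial order on labels. A specification $\mathbb S$ is a set of closed rules $P(\bar t)\leftarrow C$ such that two rules for the same symbol whose heads, renamed apart, unify are equal. A configuration $\langle\mathcal G\mid\overline C\mid U\mid H\rangle$ consists of a scope graph $\mathcal G=\langle S,R,\rho\rangle$ (scopes, labelled edges, a partial map from scopes to data terms), a multiset $\overline C$ of constraints, a partial map $U$ from variables to holes, and a partial map $H$ from holes to pairs (list of scopes, term). A substitution acts on all four components; on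 $U$, a variable related to a hole passes this relation on to all variables of the term replacing it, and the result is undefined (so that the step is impossible) if a variable would be related to two holes. **Solver.** The relation $\to$ has the following steps, applied to one constraint of the multiset. $C_1*C_2$ is split; $\mathsf{emp}$ is dropped; $\exists x.C$ is opened with a fresh variable; $t_1=t_2$ is removed and a most general unifier is applied to the configuration; $\mathsf{single}(t,\{t'\})$ becomes $t=t'$; $\forall x\in\zeta.\,C$ becomes the constraints $C[t/x]$, $t\in\zeta$; $\nabla x\mapsto t$ with $x$ a variable adds a scope $s\notin S$ with data $t$ and substitutes $s$ for $x$; $s_1\xrightarrow{l}s_2$ adds that edge; $\mathsf{dataOf}(s,t)$ becomes $t=\rho(s)$; $P(\bar t)$ is replaced by the body of a rule, and a most general unifier of $\bar t$ with the (freshly renamed) head is applied, provided that it is the only rule whose head unifies with $\bar t$; $\mathsf{query}^o\,s\,r\,(\lambda y.E)\,\mathsf{as}\,z.\,C$ becomes $C[A/z]$ if $\lambda y.E$ is ground, its answer $A$ is defined, and the query is guarded. The *answer* is the set of those paths from $s$ (visiting no scope twice, coded as terms) whose label word lies in $L(r)$ and whose target satisfies $E$, and that are not shadowed by another such path (one whose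 word has an $o$-smaller label at the first position where the words differ). It is defined if for every target of a path with word in $L(r)$, either $E$ holds for the target without instantiating free variables, or $E$ fails under every instantiation of variables and every extension of the data. The query is *guarded* if there are no scope $s'$ and label $l$ such that some path from $s$ to $s'$ has a word $w$ with $wl$ a prefix of a word of $L(r)$, and some unfolding (by rules of $\mathbb S$, arbitrary query answers and arbitrary instantiation of variables, except that a variable for which a constraint still has to create a scope is not instantiated to an existing scope) of the query's continuation or of the other constraints asserts an $l$-edge out of $s'$. Finally, the whole multiset becomes $\{\mathsf{false}\}$ if it contains $\mathsf{false}$ and something else, or an equality of non-unifiable terms, or $\mathsf{single}(t,\zeta)$ with $\zeta$ not a singleton, or a predicate constraint that unifies with no rule head. Write $\kappa\to^\bullet\kappa'$ if $\kappa\to^*\kappa'$ and $\kappa'$ admits no step. **Never stuck.** $\mathbb S\vdash P_0\ \mathbf{init}$ means: for every ground term $\mathcal P$ and every $\kappa$ with $\langle\emptyset\mid P_0(\mathcal P)\mid\emptyset\mid\emptyset\rangle\to^\bullet\kappa$, the constraints of $\kappa$ are $\emptyset$ or $\{\mathsf{false}\}$. **Synthesis.** A *speculative expansion* of a configuration applies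 a substitution $\theta$ to it without removing a constraint. Either (a) $\theta$ is a most general unifier of the arguments of a predicate constraint with the head of any rule; or (b) for a constraint $\mathsf{query}^o\,t\,r\,(\lambda y.E)\,\mathsf{as}\,z.\,C$, a variable $x$ free in $\lambda y.E$ with $U(x)=h$, $H(h)=(s_t\cdot\bar s,t')$, and scopes $s',s''$ of $\mathcal G$, where $s_t=s''$ or $s_t$ occurs in $\rho(s'')$, one has $\theta=\theta_1\theta_2$ with $\theta_1$ a most general unifier of $t$ and $s'$, and $\theta_2$ a unifier obtained by solving $E[s''/y]\theta_1$ in $\mathcal G$, such that after $\theta$ the query with source $s'$ has a defined answer containing a path to $s''$ and is guarded against the other constraints; then moreover $H(h)$ becomes $(s'\cdot s_t\cdot\bar s,t')$. A configuration is *accepting* if it has no constraints and every hole in the domain of $H$ has a scope list of length $>1$. On sets of configurations, $\twoheadrightarrow$ either performs a step $\to$ on one element, or replaces one element that is not accepting and admits no $\to$-step by all its speculative expansions. For a program $\mathcal P$ with locked references (a term without variables in which some leaves are references locked to declarations $d$, which are ground terms), $\mathsf{synthesize}(\mathcal P)=\mathcal P'$ means the following. Replace each locked reference by its own variable $x$,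 with target $D(x)=d$ and its own hole $U(x)$, to get $\mathcal P_0$. For some $\mathcal G_0$ and $\overline C$, $\langle\emptyset\mid P_0(\mathcal P_0)\mid U\mid\emptyset\rangle\to^*\langle\mathcal G_0\mid\overline C\mid U\mid\emptyset\rangle$. Put $H(U(x))=(s_d,x)$ for some scope $s_d$ whose data in $\mathcal G_0$ contains $D(x)$ as a subterm (undefined if there is none). Then $\{\langle\mathcal G_0\mid\overline C\mid U\mid H\rangle\}\twoheadrightarrow^*K$ for some $K$ that has an accepting element with hole state $H'$, and $\mathcal P'$ is obtained from $\mathcal P_0$ by replacing each $x$ with $H'(U(x))=(\bar s,t)$ by $t$. **Theorem (Soundness 1: synthesized programs are well-typed).** Let $\mathbb S$ be a specification and $P_0$ a predicate symbol with $\mathbb S\vdash P_0\ \mathbf{init}$. If $\mathsf{synthesize}(\mathcal P)=\mathcal P'$ and the synthesized program $\mathcal P'$ is ground (every locked reference has been replaced by a concrete reference), then there is a scope graph $\mathcal G$ with $$\mathbb S\vdash\langle\emptyset\mid P_0(\mathcal P')\mid\emptyset\mid\emptyset\rangle\to^\bullet\langle\mathcal G\mid\emptyset\mid\emptyset\mid\emptyset\rangle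 .$$ -/

import Mathlib

namespace Statix

/-! ## Symbols, terms and constraints -/

/-- Unification variables. -/
abbrev Var := ℕ
/-- Scope graph nodes. -/
abbrev Scope := ℕ
/-- Hole identifiers. -/
abbrev Hole := ℕ

/-- The symbol sets a specification language is built from. -/
structure Signature where
  /-- term constructors -/
  Ctor : Type
  /-- edge labels -/
  Label : Type
  /-- predicate symbols -/
  Pred : Type

/-- Term constructors, together with the two built-in constructors that represent scope graph
paths as terms. -/
inductive Sym (S : Signature) : Type
  | user (f : S.Ctor)
  | pathEnd
  | pathStep

/-- Terms `x | f(t*) | l | s` with variables drawn from `V`. -/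
inductive Term (S : Signature) (V : Type) : Type
  | var (x : V)
  | app (f : Sym S) (n : ℕ) (args : Fin n → Term S V)
  | lbl (l : S.Label)
  | scope (s : Scope)

namespace Term

variable {S : Signature} {V W : Type}

/-- Simultaneous substitution. -/
def bind : Term S V → (V → Term S W) → Term S W
  | var x, σ => σ x
  | app f n args, σ => app f n (fun i => (args i).bind σ)
  | lbl l, _ => lbl l
  | scope s, _ => scope s

/-- Renaming of variables. -/
def map (g : V → W) (t : Term S V) : Term S W := t.bind (fun x => var (g x))

/-- `x` occurs (free) in the term. -/
def Occurs (x : V) : Term S V → Prop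
  | var y => y = x
  | app _ _ args => ∃ i, (args i).Occurs x
  | lbl _ => False
  | scope _ => False

/-- The term contains no variables. -/
def IsGround (t : Term S V) : Prop := ∀ x, ¬ t.Occurs x

/-- Every variable of the term occurs exactly once in it. -/
def Linear : Term S V → Prop
  | var _ => True
  | app _ _ args => (∀ i, (args i).Linear) ∧
      ∀ i j, i ≠ j → ∀ x, (args i).Occurs x → ¬ (args j).Occurs x
  | lbl _ => True
  | scope _ => True

/-- Syntactic subterm relation. -/
inductive IsSubterm (t : Term S V) : Term S V → Prop
  | refl : IsSubterm t t
  | arg (f : Sym S) (n : ℕ) (args : Fin n → Term S V) (i : Fin n) :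
      IsSubterm t (args i) → IsSubterm t (app f n args)

end Term

/-- Lifting a substitution below one binder. The variable bound by the innermost binder is `none`,
every other variable `x` is `some x`. -/
def liftSubst {S : Signature} {V W : Type} (σ : V → Term S W) : Option V → Term S (Option W)
  | none => .var none
  | some x => (σ x).map some

/-- The substitution that instantiates the innermost bound variable by `t`. -/
def openSubst {S : Signature} {V : Type} (t : Term S V) : Option V → Term S V
  | none => t
  | some x => .var x

/-- Equality constraints `E`. A constructor with a binder has a body over `Option V`. -/
inductive EqConstraint (S : Signature) : Type → Type 1
  | eq {V : Type} (t₁ t₂ : Term S V) : EqConstraint S V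
  | dataOf {V : Type} (t₁ t₂ : Term S V) : EqConstraint S V
  | conj {V : Type} (E₁ E₂ : EqConstraint S V) : EqConstraint S V
  | ex {V : Type} (E : EqConstraint S (Option V)) : EqConstraint S V

namespace EqConstraint

variable {S : Signature}

/-- Capture-avoiding simultaneous substitution. -/
def bind : {V W : Type} → EqConstraint S V → (V → Term S W) → EqConstraint S W
  | _, _, eq t₁ t₂, σ => eq (t₁.bind σ) (t₂.bind σ)
  | _, _, dataOf t₁ t₂, σ => dataOf (t₁.bind σ) (t₂.bind σ)
  | _, _, conj E₁ E₂, σ => conj (E₁.bind σ) (E₂.bind σ)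
  | _, _, ex E, σ => ex (E.bind (liftSubst σ))

/-- `E[t/x]` for the bound variable `x` of a binder with body `E`. -/
def inst {V : Type} (E : EqConstraint S (Option V)) (t : Term S V) : EqConstraint S V :=
  E.bind (openSubst t)

/-- `x` occurs free. -/
def Occurs : {V : Type} → V → EqConstraint S V → Prop
  | _, x, eq t₁ t₂ => t₁.Occurs x ∨ t₂.Occurs x
  | _, x, dataOf t₁ t₂ => t₁.Occurs x ∨ t₂.Occurs x
  | _, x, conj E₁ E₂ => E₁.Occurs x ∨ E₂.Occurs x
  | _, x, ex E => E.Occurs (some x)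

end EqConstraint

/-- Set terms: set variables from `Z` and set literals. A literal, which is a finite union
of singletons, is given by the multiset of its elements. -/
inductive SetTerm (S : Signature) (V Z : Type) : Type
  | var (z : Z)
  | lit (ζ : Multiset (Term S V))

namespace SetTerm

variable {S : Signature} {V W Z Z' : Type}

/-- Substitution of term variables. -/
def bind (T : SetTerm S V Z) (σ : V → Term S W) : SetTerm S W Z :=
  match T with
  | var z => var z
  | lit ζ => lit (ζ.map (fun t => t.bind σ))

/-- Substitution of set variables. -/
def sbind (T : SetTerm S V Z) (τ : Z → SetTerm S V Z') : SetTerm S V Z' :=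
  match T with
  | var z => τ z
  | lit ζ => lit ζ

/-- `x` occurs in the set term. -/
def Occurs (x : V) : SetTerm S V Z → Prop
  | var _ => False
  | lit ζ => ∃ t ∈ ζ, t.Occurs x

/-- Lifting a set substitution below a binder for a set variable. -/
def liftSet (τ : Z → SetTerm S V Z') : Option Z → SetTerm S V (Option Z')
  | none => var none
  | some z =>
    match τ z with
    | var z' => var (some z')
    | lit ζ => lit ζ

end SetTerm

/-- Constraints over term variables `V` and set variables `Z`. The grammar also has equality
constraints as constraints: their conjunction and existential quantifier are those of
constraints, and the two atomic ones are the constructors `eq` and `dataOf`.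
In `query o t r E C` the order `o` is the visibility policy, `t` is the source scope, `r` is the
reachability policy, `E` is the data well-formedness condition (binding the target scope), and `C`
is the continuation (binding the answer set). -/
inductive Constraint (S : Signature) : Type → Type → Type 1
  | emp {V Z : Type} : Constraint S V Z
  | fls {V Z : Type} : Constraint S V Z
  | conj {V Z : Type} (C₁ C₂ : Constraint S V Z) : Constraint S V Z
  | ex {V Z : Type} (C : Constraint S (Option V) Z) : Constraint S V Z
  | single {V Z : Type} (t : Term S V) (T : SetTerm S V Z) : Constraint S V Z
  | all {V Z : Type} (T : SetTerm S V Z) (C : Constraint S (Option V) Z) : Constraint S V Z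
  | new {V Z : Type} (t₁ t₂ : Term S V) : Constraint S V Z
  | edge {V Z : Type} (t₁ : Term S V) (l : S.Label) (t₂ : Term S V) : Constraint S V Z
  | query {V Z : Type} (o : PartialOrder S.Label) (t : Term S V) (r : RegularExpression S.Label)
      (E : EqConstraint S (Option V)) (C : Constraint S V (Option Z)) : Constraint S V Z
  | eq {V Z : Type} (t₁ t₂ : Term S V) : Constraint S V Z
  | dataOf {V Z : Type} (t₁ t₂ : Term S V) : Constraint S V Z
  | pred {V Z : Type} (P : S.Pred) (ts : List (Term S V)) : Constraint S V Z

namespace Constraint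

variable {S : Signature}

/-- Capture-avoiding simultaneous substitution of term variables. -/
def bind : {V W Z : Type} → Constraint S V Z → (V → Term S W) → Constraint S W Z
  | _, _, _, emp, _ => emp
  | _, _, _, fls, _ => fls
  | _, _, _, conj C₁ C₂, σ => conj (C₁.bind σ) (C₂.bind σ)
  | _, _, _, ex C, σ => ex (C.bind (liftSubst σ))
  | _, _, _, single t T, σ => single (t.bind σ) (T.bind σ)
  | _, _, _, all T C, σ => all (T.bind σ) (C.bind (liftSubst σ))
  | _, _, _, new t₁ t₂, σ => new (t₁.bind σ) (t₂.bind σ)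
  | _, _, _, edge t₁ l t₂, σ => edge (t₁.bind σ) l (t₂.bind σ)
  | _, _, _, query o t r E C, σ => query o (t.bind σ) r (E.bind (liftSubst σ)) (C.bind σ)
  | _, _, _, eq t₁ t₂, σ => eq (t₁.bind σ) (t₂.bind σ)
  | _, _, _, dataOf t₁ t₂, σ => dataOf (t₁.bind σ) (t₂.bind σ)
  | _, _, _, pred P ts, σ => pred P (ts.map (fun t => t.bind σ))

/-- Capture-avoiding simultaneous substitution of set variables. -/
def sbind : {V Z Z' : Type} → Constraint S V Z → (Z → SetTerm S V Z') → Constraint S V Z'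
  | _, _, _, emp, _ => emp
  | _, _, _, fls, _ => fls
  | _, _, _, conj C₁ C₂, τ => conj (C₁.sbind τ) (C₂.sbind τ)
  | _, _, _, ex C, τ => ex (C.sbind (fun z => (τ z).bind (fun x => .var (some x))))
  | _, _, _, single t T, τ => single t (T.sbind τ)
  | _, _, _, all T C, τ =>
      all (T.sbind τ) (C.sbind (fun z => (τ z).bind (fun x => .var (some x))))
  | _, _, _, new t₁ t₂, _ => new t₁ t₂
  | _, _, _, edge t₁ l t₂, _ => edge t₁ l t₂
  | _, _, _, query o t r E C, τ => query o t r E (C.sbind (SetTerm.liftSet τ))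
  | _, _, _, eq t₁ t₂, _ => eq t₁ t₂
  | _, _, _, dataOf t₁ t₂, _ => dataOf t₁ t₂
  | _, _, _, pred P ts, _ => pred P ts

/-- `C[t/x]` for the bound term variable `x` of a binder with body `C`. -/
def inst {V Z : Type} (C : Constraint S (Option V) Z) (t : Term S V) : Constraint S V Z :=
  C.bind (openSubst t)

/-- `C[A/z]` for the bound set variable `z` of a query with continuation `C`. -/
def instSet {V Z : Type} (C : Constraint S V (Option Z)) (A : Multiset (Term S V)) :
    Constraint S V Z :=
  C.sbind (fun z => match z with
    | none => .lit A
    | some z => .var z)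

/-- `x` occurs free. -/
def Occurs : {V Z : Type} → V → Constraint S V Z → Prop
  | _, _, _, emp => False
  | _, _, _, fls => False
  | _, _, x, conj C₁ C₂ => C₁.Occurs x ∨ C₂.Occurs x
  | _, _, x, ex C => C.Occurs (some x)
  | _, _, x, single t T => t.Occurs x ∨ T.Occurs x
  | _, _, x, all T C => T.Occurs x ∨ C.Occurs (some x)
  | _, _, x, new t₁ t₂ => t₁.Occurs x ∨ t₂.Occurs x
  | _, _, x, edge t₁ _ t₂ => t₁.Occurs x ∨ t₂.Occurs x
  | _, _, x, query _ t _ E C => t.Occurs x ∨ E.Occurs (some x) ∨ C.Occurs x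
  | _, _, x, eq t₁ t₂ => t₁.Occurs x ∨ t₂.Occurs x
  | _, _, x, dataOf t₁ t₂ => t₁.Occurs x ∨ t₂.Occurs x
  | _, _, x, pred _ ts => ∃ t ∈ ts, t.Occurs x

/-- The constraint asserts, in one of its conjuncts, the creation of a new scope for `x`. -/
def Creates : {V Z : Type} → V → Constraint S V Z → Prop
  | _, _, x, conj C₁ C₂ => C₁.Creates x ∨ C₂.Creates x
  | _, _, x, ex C => C.Creates (some x)
  | _, _, x, new (.var y) _ => y = x
  | _, _, _, _ => False

end Constraint

/-! ## Substitutions and unification -/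

/-- Substitutions of unification variables (the identity outside of their domain). -/
abbrev Subst (S : Signature) := Var → Term S Var

/-- `θ₁θ₂`: first apply `θ₁`, then `θ₂`. -/
def Subst.comp {S : Signature} (θ₁ θ₂ : Subst S) : Subst S := fun x => (θ₁ x).bind θ₂

/-- `[t/x]` -/
def Subst.one {S : Signature} (x : Var) (t : Term S Var) : Subst S :=
  Function.update Term.var x t

/-- `θ` unifies the two sequences of terms. -/
def Unifies {S : Signature} (θ : Subst S) (ts us : List (Term S Var)) : Prop :=
  ts.map (fun t => t.bind θ) = us.map (fun t => t.bind θ)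

/-- `θ` is a most general unifier of the two sequences of terms: a unifier with `σ = θσ` for every
unifier `σ`. So `θ` is idempotent, and does not touch other variables. -/
def IsMGU {S : Signature} (θ : Subst S) (ts us : List (Term S Var)) : Prop :=
  Unifies θ ts us ∧ ∀ σ, Unifies σ ts us → θ.comp σ = σ

/-! ## Specifications -/

/-- A rule `P(head) ← body`. It is closed: its variables are those of the head, here numbered
by `Fin k`. -/
structure Rule (S : Signature) where
  pred : S.Pred
  k : ℕ
  head : List (Term S (Fin k))
  body : Constraint S (Fin k) Empty
  closed : ∀ i, ∃ t ∈ head, t.Occurs i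

/-- The head of the rule (renamed apart) unifies with the argument sequence `ts` of a constraint
with predicate symbol `P`. -/
def Rule.Matches {S : Signature} (R : Rule S) (P : S.Pred) (ts : List (Term S Var)) : Prop :=
  R.pred = P ∧ ∃ (σ : Subst S) (τ : Fin R.k → Term S Var),
    ts.map (fun t => t.bind σ) = R.head.map (fun t => t.bind τ)

/-- A specification is a set of rules with pairwise disjoint domains: two rules for the same
predicate symbol whose heads (renamed apart) unify are equal. -/
structure Spec (S : Signature) where
  rules : Set (Rule S)
  disjoint : ∀ R₁ ∈ rules, ∀ R₂ ∈ rules, R₁.pred = R₂.pred →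
    (∃ (τ₁ : Fin R₁.k → Term S Var) (τ₂ : Fin R₂.k → Term S Var),
      R₁.head.map (fun t => t.bind τ₁) = R₂.head.map (fun t => t.bind τ₂)) → R₁ = R₂

/-! ## Scope graphs and queries -/

/-- Scope graphs: nodes, labeled edges, and the data associated with nodes. -/
structure Graph (S : Signature) where
  nodes : Set Scope
  edges : Set (Scope × S.Label × Scope)
  data : Scope → Option (Term S Var)

namespace Graph

variable {S : Signature}

/-- The empty scope graph. -/
def empty : Graph S := ⟨∅, ∅, fun _ => none⟩

/-- Substitution in the data of a scope graph. -/
def subst (G : Graph S) (θ : Subst S) : Graph S :=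
  { G with data := fun s => (G.data s).map (fun t => t.bind θ) }

/-- Add the node `s` with data `t`. -/
def addNode (G : Graph S) (s : Scope) (t : Term S Var) : Graph S :=
  { G with nodes := insert s G.nodes, data := Function.update G.data s (some t) }

/-- Add an edge. -/
def addEdge (G : Graph S) (s₁ : Scope) (l : S.Label) (s₂ : Scope) : Graph S :=
  { G with edges := insert (s₁, l, s₂) G.edges }

/-- `p` is the list of steps of a walk that starts in `s`. -/
def IsWalk (G : Graph S) (s : Scope) : List (S.Label × Scope) → Prop
  | [] => True
  | (l, s') :: p => (s, l, s') ∈ G.edges ∧ G.IsWalk s' p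

/-- `p` is the list of steps of a path that starts in `s`: a walk that visits no scope twice. -/
def IsPath (G : Graph S) (s : Scope) (p : List (S.Label × Scope)) : Prop :=
  G.IsWalk s p ∧ (s :: p.map Prod.snd).Nodup

end Graph

/-- The target of the path from `s` with steps `p`. -/
def pathTgt {L : Type} (s : Scope) : List (L × Scope) → Scope
  | [] => s
  | (_, s') :: p => pathTgt s' p

/-- The path from `s` with steps `p` as a term. -/
def pathTerm {S : Signature} (s : Scope) : List (S.Label × Scope) → Term S Var
  | [] => .app .pathEnd 1 ![.scope s]
  | (l, s') :: p => .app .pathStep 3 ![.scope s, .lbl l, pathTerm s' p]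

/-- The words along paths are compared by the label order at the first position where they
differ. -/
def WordLT {L : Type} (o : PartialOrder L) (w₁ w₂ : List L) : Prop :=
  ∃ (u v₁ v₂ : List L) (l₁ l₂ : L), w₁ = u ++ l₁ :: v₁ ∧ w₂ = u ++ l₂ :: v₂ ∧ o.lt l₁ l₂

/-- An equality constraint holds with respect to the data `ρ` as it stands, that is, without
instantiation of its free variables. -/
inductive Holds {S : Signature} (ρ : Scope → Option (Term S Var)) : EqConstraint S Var → Prop
  | eq (t : Term S Var) : Holds ρ (.eq t t)
  | dataOf (s : Scope) (t : Term S Var) : ρ s = some t → Holds ρ (.dataOf (.scope s) t)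
  | conj (E₁ E₂ : EqConstraint S Var) : Holds ρ E₁ → Holds ρ E₂ → Holds ρ (.conj E₁ E₂)
  | ex (E : EqConstraint S (Option Var)) (t : Term S Var) : Holds ρ (E.inst t) → Holds ρ (.ex E)

/-- An equality constraint is refuted by `ρ`: it holds under no instantiation of variables and no
extension of the data. -/
def Refuted {S : Signature} (ρ : Scope → Option (Term S Var)) (E : EqConstraint S Var) : Prop :=
  ∀ (σ : Subst S) (ρ' : Scope → Option (Term S Var)),
    (∀ s t, ρ s = some t → ρ' s = some (t.bind σ)) → ¬ Holds ρ' (E.bind σ)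

/-- `p` is a path from `s` whose word matches `r`. -/
def Reaches {S : Signature} (G : Graph S) (s : Scope) (r : RegularExpression S.Label)
    (p : List (S.Label × Scope)) : Prop :=
  G.IsPath s p ∧ p.map Prod.fst ∈ r.matches'

/-- `A` is the answer set of the query `query o s r (λ y. E)`: the reachable paths whose target
satisfies `E` and that are not shadowed by another such path. The answer is defined only if the
graph determines for each reachable target whether it satisfies `E`, so that later instantiation
of variables in the data cannot change it. -/
def IsAnswer {S : Signature} (G : Graph S) (o : PartialOrder S.Label) (s : Scope)
    (r : RegularExpression S.Label) (E : EqConstraint S (Option Var))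
    (A : Set (List (S.Label × Scope))) : Prop :=
  (∀ p, Reaches G s r p →
    Holds G.data (E.inst (.scope (pathTgt s p))) ∨
      Refuted G.data (E.inst (.scope (pathTgt s p)))) ∧
  ∀ p, p ∈ A ↔
    (Reaches G s r p ∧ Holds G.data (E.inst (.scope (pathTgt s p)))) ∧
    ¬ ∃ p', (Reaches G s r p' ∧ Holds G.data (E.inst (.scope (pathTgt s p')))) ∧
      WordLT o (p'.map Prod.fst) (p.map Prod.fst)

/-- A new edge with label `l` and source `s'` could contribute to a path that matches `r`:
there is a path from `s` to `s'` whose word, followed by `l`, is a prefix of a word of `r`. -/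
def WeaklyCritical {S : Signature} (G : Graph S) (s : Scope) (r : RegularExpression S.Label)
    (s' : Scope) (l : S.Label) : Prop :=
  ∃ p w, G.IsPath s p ∧ pathTgt s p = s' ∧ p.map Prod.fst ++ l :: w ∈ r.matches'

/-- Some unfolding of the constraint asserts an edge with label `l` and source `s`. Answers of
nested queries are arbitrary, predicates are unfolded by any rule that applies, and existentially
quantified variables stand for any term, except that a variable for which the body creates
a new scope does not stand for one of the existing scopes `N`. -/
inductive Supports {S : Signature} (𝕊 : Spec S) (N : Set Scope) (s : Scope) (l : S.Label) :
    Constraint S Var Empty → Prop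
  | edge (t : Term S Var) : Supports 𝕊 N s l (.edge (.scope s) l t)
  | left (C₁ C₂ : Constraint S Var Empty) :
      Supports 𝕊 N s l C₁ → Supports 𝕊 N s l (.conj C₁ C₂)
  | right (C₁ C₂ : Constraint S Var Empty) :
      Supports 𝕊 N s l C₂ → Supports 𝕊 N s l (.conj C₁ C₂)
  | ex (C : Constraint S (Option Var) Empty) (t : Term S Var) :
      (∀ s' ∈ N, t = .scope s' → ¬ C.Creates none) →
      Supports 𝕊 N s l (C.inst t) → Supports 𝕊 N s l (.ex C)
  | all (ζ : Multiset (Term S Var)) (C : Constraint S (Option Var) Empty) (t : Term S Var) :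
      t ∈ ζ → Supports 𝕊 N s l (C.inst t) → Supports 𝕊 N s l (.all (.lit ζ) C)
  | query (o : PartialOrder S.Label) (t : Term S Var) (r : RegularExpression S.Label)
      (E : EqConstraint S (Option Var)) (C : Constraint S Var (Option Empty))
      (A : Multiset (Term S Var)) :
      Supports 𝕊 N s l (C.instSet A) → Supports 𝕊 N s l (.query o t r E C)
  | pred (R : Rule S) (τ : Fin R.k → Term S Var) : R ∈ 𝕊.rules →
      Supports 𝕊 N s l (R.body.bind τ) →
      Supports 𝕊 N s l (.pred R.pred (R.head.map (fun t => t.bind τ)))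

/-- Solving the constraints `cs` may add an edge with label `l` and source `s` to `G`: some
instantiation of their free variables supports it. A variable for which a new scope is still to be
created is not instantiated to a scope of `G`. -/
def MayExtend {S : Signature} (𝕊 : Spec S) (G : Graph S)
    (cs : Multiset (Constraint S Var Empty)) (s : Scope) (l : S.Label) : Prop :=
  ∃ σ : Subst S, (∀ x, ∀ s' ∈ G.nodes, σ x = .scope s' → ∀ C ∈ cs, ¬ C.Creates x) ∧
    ∃ C ∈ cs, Supports 𝕊 G.nodes s l (C.bind σ)

/-- `guard(G, (query o s r (λ y. E) z. C), cs)`: the constraints `C; cs` do not add an edge that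
could change the answer of the query. -/
def Guard {S : Signature} (𝕊 : Spec S) (G : Graph S) (o : PartialOrder S.Label) (s : Scope)
    (r : RegularExpression S.Label) (E : EqConstraint S (Option Var))
    (C : Constraint S Var (Option Empty)) (cs : Multiset (Constraint S Var Empty)) : Prop :=
  ∀ s' l, WeaklyCritical G s r s' l → ¬ MayExtend 𝕊 G (.query o (.scope s) r E C ::ₘ cs) s' l

/-! ## Configurations -/

/-- The partial map from unification variables to the holes they are related to. -/
abbrev HoleMap := Var → Option Hole

/-- The partial map from holes to the traversed scopes and the term constructed so far. -/
abbrev HoleState (S : Signature) := Hole → Option (List Scope × Term S Var)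

/-- `U' = Uθ`. A variable related to a hole passes this relation on to all variables of the term
it is substituted by. There is no such `U'` if a variable would be related to two holes. -/
def HoleMap.SubstTo {S : Signature} (U : HoleMap) (θ : Subst S) (U' : HoleMap) : Prop :=
  (∀ x h, U x = some h → U' x = some h ∧ ∀ y, (θ x).Occurs y → U' y = some h) ∧
  ∀ y h, U' y = some h → U y = some h ∨ ∃ x, U x = some h ∧ (θ x).Occurs y

/-- `Hθ` -/
def HoleState.subst {S : Signature} (H : HoleState S) (θ : Subst S) : HoleState S :=
  fun h => (H h).map (fun p => (p.1, p.2.bind θ))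

/-- Solver configurations `⟨ G | cs | U | H ⟩`. -/
structure Config (S : Signature) where
  graph : Graph S
  cs : Multiset (Constraint S Var Empty)
  U : HoleMap
  H : HoleState S

namespace Config

variable {S : Signature}

/-- `κ' = κθ` -/
def SubstTo (κ : Config S) (θ : Subst S) (κ' : Config S) : Prop :=
  κ'.graph = κ.graph.subst θ ∧ κ'.cs = κ.cs.map (fun C => C.bind θ) ∧
    κ.U.SubstTo θ κ'.U ∧ κ'.H = κ.H.subst θ

/-- The variable `x` is in use in `κ`; the others are fresh. -/
def Uses (κ : Config S) (x : Var) : Prop :=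
  (∃ s t, κ.graph.data s = some t ∧ t.Occurs x) ∨ (∃ C ∈ κ.cs, C.Occurs x) ∨
    κ.U x ≠ none ∨ ∃ h p, κ.H h = some p ∧ p.2.Occurs x

/-- `⟨ ∅ | P₀(t) | U | ∅ ⟩` -/
def initial (P₀ : S.Pred) (t : Term S Var) (U : HoleMap) : Config S :=
  ⟨Graph.empty, {.pred P₀ [t]}, U, fun _ => none⟩

end Config

/-- `κ → κ'`: one step of the plain solver. The last four rules reject: a constraint that has no
solution under any instantiation turns the constraint set into `{false}`. -/
inductive Step {S : Signature} (𝕊 : Spec S) : Config S → Config S → Prop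
  | conj (G : Graph S) (C₁ C₂ : Constraint S Var Empty) (cs : Multiset (Constraint S Var Empty))
      (U : HoleMap) (H : HoleState S) :
      Step 𝕊 ⟨G, .conj C₁ C₂ ::ₘ cs, U, H⟩ ⟨G, C₁ ::ₘ C₂ ::ₘ cs, U, H⟩
  | emp (G : Graph S) (cs : Multiset (Constraint S Var Empty)) (U : HoleMap) (H : HoleState S) :
      Step 𝕊 ⟨G, .emp ::ₘ cs, U, H⟩ ⟨G, cs, U, H⟩
  | ex (G : Graph S) (C : Constraint S (Option Var) Empty)
      (cs : Multiset (Constraint S Var Empty)) (U : HoleMap) (H : HoleState S) (y : Var) :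
      ¬ Config.Uses ⟨G, .ex C ::ₘ cs, U, H⟩ y →
      Step 𝕊 ⟨G, .ex C ::ₘ cs, U, H⟩ ⟨G, C.inst (.var y) ::ₘ cs, U, H⟩
  | eq (G : Graph S) (t₁ t₂ : Term S Var) (cs : Multiset (Constraint S Var Empty))
      (U : HoleMap) (H : HoleState S) (θ : Subst S) (κ' : Config S) :
      IsMGU θ [t₁] [t₂] → Config.SubstTo ⟨G, cs, U, H⟩ θ κ' →
      Step 𝕊 ⟨G, .eq t₁ t₂ ::ₘ cs, U, H⟩ κ'
  | single (G : Graph S) (t t' : Term S Var) (cs : Multiset (Constraint S Var Empty))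
      (U : HoleMap) (H : HoleState S) :
      Step 𝕊 ⟨G, .single t (.lit {t'}) ::ₘ cs, U, H⟩ ⟨G, .eq t t' ::ₘ cs, U, H⟩
  | all (G : Graph S) (ζ : Multiset (Term S Var)) (C : Constraint S (Option Var) Empty)
      (cs : Multiset (Constraint S Var Empty)) (U : HoleMap) (H : HoleState S) :
      Step 𝕊 ⟨G, .all (.lit ζ) C ::ₘ cs, U, H⟩ ⟨G, ζ.map (fun t => C.inst t) + cs, U, H⟩
  | newScope (G : Graph S) (x : Var) (t : Term S Var) (cs : Multiset (Constraint S Var Empty))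
      (U : HoleMap) (H : HoleState S) (s : Scope) (κ' : Config S) :
      s ∉ G.nodes → Config.SubstTo ⟨G.addNode s t, cs, U, H⟩ (Subst.one x (.scope s)) κ' →
      Step 𝕊 ⟨G, .new (.var x) t ::ₘ cs, U, H⟩ κ'
  | newEdge (G : Graph S) (s₁ : Scope) (l : S.Label) (s₂ : Scope)
      (cs : Multiset (Constraint S Var Empty)) (U : HoleMap) (H : HoleState S) :
      Step 𝕊 ⟨G, .edge (.scope s₁) l (.scope s₂) ::ₘ cs, U, H⟩ ⟨G.addEdge s₁ l s₂, cs, U, H⟩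
  | data (G : Graph S) (s : Scope) (t₁ t₂ : Term S Var) (cs : Multiset (Constraint S Var Empty))
      (U : HoleMap) (H : HoleState S) :
      G.data s = some t₂ →
      Step 𝕊 ⟨G, .dataOf (.scope s) t₁ ::ₘ cs, U, H⟩ ⟨G, .eq t₁ t₂ ::ₘ cs, U, H⟩
  | query (G : Graph S) (o : PartialOrder S.Label) (s : Scope) (r : RegularExpression S.Label)
      (E : EqConstraint S (Option Var)) (C : Constraint S Var (Option Empty))
      (cs : Multiset (Constraint S Var Empty)) (U : HoleMap) (H : HoleState S)
      (A : Set (List (S.Label × Scope))) (ζ : Multiset (Term S Var)) :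
      (∀ x, ¬ E.Occurs (some x)) → IsAnswer G o s r E A → Guard 𝕊 G o s r E C cs →
      ζ.Nodup → (∀ t, t ∈ ζ ↔ ∃ p ∈ A, pathTerm s p = t) →
      Step 𝕊 ⟨G, .query o (.scope s) r E C ::ₘ cs, U, H⟩ ⟨G, C.instSet ζ ::ₘ cs, U, H⟩
  | pred (G : Graph S) (P : S.Pred) (ts : List (Term S Var))
      (cs : Multiset (Constraint S Var Empty)) (U : HoleMap) (H : HoleState S) (R : Rule S)
      (v : Fin R.k → Var) (θ : Subst S) (κ' : Config S) :
      R ∈ 𝕊.rules → R.pred = P → (∀ R' ∈ 𝕊.rules, R'.Matches P ts → R' = R) →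
      Function.Injective v → (∀ i, ¬ Config.Uses ⟨G, .pred P ts ::ₘ cs, U, H⟩ (v i)) →
      IsMGU θ ts (R.head.map (fun t => t.map v)) →
      Config.SubstTo ⟨G, R.body.bind (fun i => .var (v i)) ::ₘ cs, U, H⟩ θ κ' →
      Step 𝕊 ⟨G, .pred P ts ::ₘ cs, U, H⟩ κ'
  | eqFail (G : Graph S) (t₁ t₂ : Term S Var) (cs : Multiset (Constraint S Var Empty))
      (U : HoleMap) (H : HoleState S) :
      (¬ ∃ θ, Unifies θ [t₁] [t₂]) → Step 𝕊 ⟨G, .eq t₁ t₂ ::ₘ cs, U, H⟩ ⟨G, {.fls}, U, H⟩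
  | singleFail (G : Graph S) (t : Term S Var) (ζ : Multiset (Term S Var))
      (cs : Multiset (Constraint S Var Empty)) (U : HoleMap) (H : HoleState S) :
      Multiset.card ζ ≠ 1 → Step 𝕊 ⟨G, .single t (.lit ζ) ::ₘ cs, U, H⟩ ⟨G, {.fls}, U, H⟩
  | predFail (G : Graph S) (P : S.Pred) (ts : List (Term S Var))
      (cs : Multiset (Constraint S Var Empty)) (U : HoleMap) (H : HoleState S) :
      (¬ ∃ R ∈ 𝕊.rules, R.Matches P ts) → Step 𝕊 ⟨G, .pred P ts ::ₘ cs, U, H⟩ ⟨G, {.fls}, U, H⟩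
  | falseFail (G : Graph S) (cs : Multiset (Constraint S Var Empty)) (U : HoleMap)
      (H : HoleState S) :
      cs ≠ 0 → Step 𝕊 ⟨G, .fls ::ₘ cs, U, H⟩ ⟨G, {.fls}, U, H⟩

/-- `κ →• κ'`: exhaustive application of the plain solver steps. -/
def Exhaustive {S : Signature} (𝕊 : Spec S) (κ κ' : Config S) : Prop :=
  Relation.ReflTransGen (Step 𝕊) κ κ' ∧ ¬ ∃ κ'', Step 𝕊 κ' κ''

/-- `𝕊 ⊢ P₀ init`: on a ground program the solver does not end in a stuck configuration. -/
def Spec.Init {S : Signature} (𝕊 : Spec S) (P₀ : S.Pred) : Prop :=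
  ∀ (P : Term S Var) (κ : Config S), P.IsGround →
    Exhaustive 𝕊 (Config.initial P₀ P (fun _ => none)) κ → κ.cs = 0 ∨ κ.cs = {.fls}

/-! ## Reference synthesis -/

/-- `G ⊢ E ⇝ θ`: the equality constraint `E` produces the unifier `θ`. The set `X` holds
the variables in use before, the set `X'` those in use afterwards. -/
inductive Produces {S : Signature} :
    Set Var → Graph S → EqConstraint S Var → Subst S → Set Var → Prop
  | eq (X : Set Var) (G : Graph S) (t₁ t₂ : Term S Var) (θ : Subst S) :
      IsMGU θ [t₁] [t₂] → Produces X G (.eq t₁ t₂) θ X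
  | dataOf (X : Set Var) (G : Graph S) (s : Scope) (d t : Term S Var) (θ : Subst S) :
      G.data s = some d → IsMGU θ [d] [t] → Produces X G (.dataOf (.scope s) t) θ X
  | conj (X X₁ X₂ : Set Var) (G : Graph S) (E₁ E₂ : EqConstraint S Var) (θ₁ θ₂ : Subst S) :
      Produces X G E₁ θ₁ X₁ → Produces X₁ (G.subst θ₁) (E₂.bind θ₁) θ₂ X₂ →
      Produces X G (.conj E₁ E₂) (θ₁.comp θ₂) X₂
  | ex (X X' : Set Var) (G : Graph S) (E : EqConstraint S (Option Var)) (y : Var)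
      (θ : Subst S) :
      y ∉ X → Produces (insert y X) G (E.inst (.var y)) θ X' → Produces X G (.ex E) θ X'

/-- `κ ↣ θ, H'`: speculative expansion of a predicate or a query constraint of `κ`. -/
inductive Expand {S : Signature} (𝕊 : Spec S) : Config S → Subst S → HoleState S → Prop
  | pred (G : Graph S) (P : S.Pred) (ts : List (Term S Var))
      (cs : Multiset (Constraint S Var Empty)) (U : HoleMap) (H : HoleState S) (R : Rule S)
      (v : Fin R.k → Var) (θ : Subst S) :
      R ∈ 𝕊.rules → R.pred = P → Function.Injective v →
      (∀ i, ¬ Config.Uses ⟨G, .pred P ts ::ₘ cs, U, H⟩ (v i)) →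
      IsMGU θ ts (R.head.map (fun t => t.map v)) →
      Expand 𝕊 ⟨G, .pred P ts ::ₘ cs, U, H⟩ θ H
  | query (G : Graph S) (o : PartialOrder S.Label) (t : Term S Var)
      (r : RegularExpression S.Label) (E : EqConstraint S (Option Var))
      (C : Constraint S Var (Option Empty)) (cs : Multiset (Constraint S Var Empty))
      (U : HoleMap) (H : HoleState S) (x : Var) (h : Hole) (sₜ : Scope) (ss : List Scope)
      (t' : Term S Var) (s' s'' : Scope) (θ₁ θ₂ : Subst S) (X' : Set Var)
      (A : Set (List (S.Label × Scope))) (p : List (S.Label × Scope)) :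
      E.Occurs (some x) → U x = some h → H h = some (sₜ :: ss, t') →
      s' ∈ G.nodes → s'' ∈ G.nodes → IsMGU θ₁ [t] [.scope s'] →
      (sₜ = s'' ∨ ∃ d, G.data s'' = some d ∧ Term.IsSubterm (.scope sₜ) d) →
      Produces {y | Config.Uses ⟨G, .query o t r E C ::ₘ cs, U, H⟩ y} G
        ((E.inst (.scope s'')).bind θ₁) θ₂ X' →
      IsAnswer (G.subst (θ₁.comp θ₂)) o s' r (E.bind (liftSubst (θ₁.comp θ₂))) A →
      p ∈ A → pathTgt s' p = s'' →
      Guard 𝕊 (G.subst (θ₁.comp θ₂)) o s' r (E.bind (liftSubst (θ₁.comp θ₂)))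
        (C.bind (θ₁.comp θ₂)) cs →
      Expand 𝕊 ⟨G, .query o t r E C ::ₘ cs, U, H⟩ (θ₁.comp θ₂)
        (Function.update H h (some (s' :: sₜ :: ss, t')))

/-- Accepting states: all constraints are solved and each hole has a composite path of
length greater than one. -/
def Accept {S : Signature} (cs : Multiset (Constraint S Var Empty)) (H : HoleState S) : Prop :=
  cs = 0 ∧ ∀ h p, H h = some p → 1 < p.1.length

/-- `K ↠ K'` on collections of configurations: solve a configuration by a plain step, or, if it
admits none and is not accepting, replace it by all its speculative expansions. -/
inductive SynthStep {S : Signature} (𝕊 : Spec S) : Set (Config S) → Set (Config S) → Prop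
  | solve (κ κ' : Config S) (K : Set (Config S)) :
      Step 𝕊 κ κ' → SynthStep 𝕊 (insert κ K) (insert κ' K)
  | expand (κ : Config S) (K : Set (Config S)) :
      (¬ ∃ κ', Step 𝕊 κ κ') → ¬ Accept κ.cs κ.H →
      SynthStep 𝕊 (insert κ K)
        ({κ' | ∃ θ H', Expand 𝕊 κ θ H' ∧ Config.SubstTo { κ with H := H' } θ κ'} ∪ K)

/-- Declarations, which are the targets of locked references, as ground terms. -/
abbrev Decl (S : Signature) := Term S Empty

/-- Programs with locked references: terms in which the leaf `var d` is a reference that is locked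
to the declaration `d`. -/
abbrev LockedProgram (S : Signature) := Term S (Decl S)

/-- The initial hole state: the hole `h` of the variable `x` has the state `(s, x)`, where `s` is
a scope whose data contains the target declaration `D x` (no state if there is no such scope). -/
def InitialHoles {S : Signature} (D : Var → Decl S) (U : HoleMap) (G : Graph S)
    (H : HoleState S) : Prop :=
  let Target (x : Var) (s : Scope) : Prop :=
    ∃ d, G.data s = some d ∧ Term.IsSubterm ((D x).map Empty.elim) d
  (∀ x h, U x = some h → (∃ s, Target x s ∧ H h = some ([s], .var x)) ∨
    ((¬ ∃ s, Target x s) ∧ H h = none)) ∧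
  ∀ h, (∀ x, U x ≠ some h) → H h = none

open Classical in
/-- The substitution of the hole variables by the synthesized terms. -/
noncomputable def resultSubst {S : Signature} (U : HoleMap) (H : HoleState S) : Subst S :=
  fun x => match (U x).bind H with
    | some (_, t) => t
    | none => .var x

/-- `synthesize(P) = P'`. The program `Q` is `P` with each locked reference replaced by a variable
of its own, `D` gives the targets of these variables, and `U` gives each of them a hole of
its own. -/
def Synthesizes {S : Signature} (𝕊 : Spec S) (P₀ : S.Pred) (P : LockedProgram S)
    (P' : Term S Var) : Prop :=
  ∃ (Q : Term S Var) (D : Var → Decl S) (U : HoleMap) (G₀ : Graph S)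
    (cs : Multiset (Constraint S Var Empty)) (H : HoleState S) (K : Set (Config S))
    (κ : Config S),
    Q.Linear ∧ Q.map D = P ∧
    (∀ x, U x ≠ none ↔ Q.Occurs x) ∧ (∀ x y h, U x = some h → U y = some h → x = y) ∧
    Relation.ReflTransGen (Step 𝕊) (Config.initial P₀ Q U) ⟨G₀, cs, U, fun _ => none⟩ ∧
    InitialHoles D U G₀ H ∧
    Relation.ReflTransGen (SynthStep 𝕊) {⟨G₀, cs, U, H⟩} K ∧
    κ ∈ K ∧ Accept κ.cs κ.H ∧ P' = Q.bind (resultSubst U κ.H)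

end Statix

/-! The accepting configuration has no constraints left, so its scope graph can serve as a fixed
final graph `G` in which constraints have a declarative meaning (`Sat`): queries are evaluated in
`G` itself, and a derivation records the scopes it creates, the edges it asserts and its size. A
model of a configuration (`Models`) instantiates the variables so that the remaining constraints are
derivable in `G`; the asserted edges complete the present graph to `G`, and the created scopes are
distinct and new.

Backwards, every solver step and every speculative expansion turns a model of its result into a
model of its source, with the substitutions composed (`Step.exists_transition`,
`Expand.transition`). The accepting configuration has a trivial model, hence the initial constraint
on the open program holds in `G` under the accumulated substitution.

Forwards, a configuration with a model that admits some step admits one to a configuration that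
again has a model, with a smaller derivation (`Models.descends_of_step`). Starting from the
synthesized program this yields an exhaustive run. Its end has a model, so it is not `{false}`; the
never-stuck hypothesis leaves only the empty constraint set. The order of solving may differ from
that of the synthesis, and no confluence is needed.

Both directions need a query answered in a partial graph to have the same answer in `G`
(`mem_visiblePaths_iff_of_guard`). Every missing edge is asserted by a derivation of a remaining
constraint and so is supported in the sense of the guard, which excludes edges that could extend a
matching path. Definedness of the answer fixes the data condition at each target.

Finally, the accumulated substitution must turn the open program into `P'`. Hole states record only
what happens after the initial solving. A hole variable instantiated earlier is eliminated from the
graph and the constraints, so the later phase leaves it alone and it would survive in `P'`;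
groundness rules this out. -/

namespace Statix

/-! ## Substitution lemmas -/

namespace Term

variable {S : Signature} {V W X : Type}

theorem bind_bind (t : Term S V) (σ : V → Term S W) (τ : W → Term S X) :
    (t.bind σ).bind τ = t.bind (fun x => (σ x).bind τ) := by
  induction t with
  | app f n args ih => simp only [bind, ih]
  | _ => simp only [bind]

theorem bind_var (t : Term S V) : t.bind var = t := by
  induction t with
  | app f n args ih => simp only [bind, ih]
  | _ => simp only [bind]

theorem bind_eq_bind_iff (t : Term S V) (σ τ : V → Term S W) :
    t.bind σ = t.bind τ ↔ ∀ x, t.Occurs x → σ x = τ x := by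
  induction t with
  | app f n args ih =>
    simp only [bind, app.injEq, heq_eq_eq, true_and, Occurs, funext_iff, ih]
    exact ⟨fun h x ⟨i, hi⟩ => h i x hi, fun h i x hi => h x ⟨i, hi⟩⟩
  | var y => simp [bind, Occurs]
  | _ => simp [bind, Occurs]

theorem occurs_bind_iff (t : Term S V) (σ : V → Term S W) (x : W) :
    (t.bind σ).Occurs x ↔ ∃ y, t.Occurs y ∧ (σ y).Occurs x := by
  induction t with
  | app f n args ih =>
    simp only [bind, Occurs, ih]
    exact ⟨fun ⟨i, y, h⟩ => ⟨y, ⟨i, h.1⟩, h.2⟩, fun ⟨y, ⟨i, h⟩, h'⟩ => ⟨i, y, h, h'⟩⟩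
  | var y => simp [bind, Occurs]
  | _ => simp [bind, Occurs]

theorem IsGround.bind_eq {t : Term S V} (h : t.IsGround) (σ : V → Term S V) : t.bind σ = t := by
  conv_rhs => rw [← bind_var t]
  exact (bind_eq_bind_iff ..).2 fun x hx => (h x hx).elim

theorem map_bind_liftSubst (t : Term S V) (σ : V → Term S W) :
    (t.map some).bind (liftSubst σ) = (t.bind σ).map some := by
  simp [Term.map, bind_bind, bind, liftSubst]

theorem map_some_bind_openSubst (t u : Term S V) : (t.map some).bind (openSubst u) = t := by
  simp [Term.map, bind_bind, bind, openSubst, bind_var]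

theorem occurs_map_some (t : Term S V) (x : V) : (t.map some).Occurs (some x) ↔ t.Occurs x := by
  simp [Term.map, occurs_bind_iff, Occurs]

end Term

section

variable {S : Signature} {V W X : Type}

theorem liftSubst_bind (σ : V → Term S W) (τ : W → Term S X) :
    (fun x => (liftSubst σ x).bind (liftSubst τ)) = liftSubst (fun x => (σ x).bind τ) := by
  funext x
  cases x with
  | none => rfl
  | some x => exact Term.map_bind_liftSubst _ _

/-- The predicate `p` stands for "occurs in the body of the binder", so that the lemma serves
equality constraints and constraints alike. -/
theorem liftSubst_congr {σ τ : V → Term S W} {p : Option V → Prop}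
    (h : ∀ x, p (some x) → σ x = τ x) (x : Option V) (hx : p x) :
    liftSubst σ x = liftSubst τ x := by
  cases x with
  | none => rfl
  | some x => simp only [liftSubst, h x hx]

theorem liftSubst_var : liftSubst (S := S) (Term.var (V := V)) = Term.var := by
  funext x
  cases x <;> rfl

theorem openSubst_bind (t : Term S V) (σ : V → Term S W) :
    (fun x => (openSubst t x).bind σ) =
      fun x => (liftSubst σ x).bind (openSubst (t.bind σ)) := by
  funext x
  cases x with
  | none => rfl
  | some x => exact (Term.map_some_bind_openSubst _ _).symm

theorem occurs_liftSubst_some {σ : V → Term S W} {p : Option V → Prop} {x : W}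
    (h : ∃ y, p y ∧ (liftSubst σ y).Occurs (some x)) :
    ∃ y, p (some y) ∧ (σ y).Occurs x := by
  obtain ⟨y, hy, hx⟩ := h
  cases y with
  | none => simp [liftSubst, Term.Occurs] at hx
  | some y => exact ⟨y, hy, (Term.occurs_map_some _ _).1 hx⟩

theorem occurs_openSubst {t : Term S V} {p : Option V → Prop} {x : V}
    (h : ∃ y, p y ∧ (openSubst t y).Occurs x) : p (some x) ∨ t.Occurs x := by
  obtain ⟨y, hy, hx⟩ := h
  cases y with
  | none => exact .inr hx
  | some y => cases hx; exact .inl hy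

end

namespace EqConstraint

variable {S : Signature}

theorem bind_bind {V W X : Type} (E : EqConstraint S V) (σ : V → Term S W)
    (τ : W → Term S X) : (E.bind σ).bind τ = E.bind (fun x => (σ x).bind τ) := by
  induction E generalizing W X with
  | ex E ih => simp only [bind, ih, liftSubst_bind]
  | conj E₁ E₂ ih₁ ih₂ => simp only [bind, ih₁, ih₂]
  | _ => simp only [bind, Term.bind_bind]

theorem bind_congr {V W : Type} (E : EqConstraint S V) (σ τ : V → Term S W)
    (h : ∀ x, E.Occurs x → σ x = τ x) : E.bind σ = E.bind τ := by
  induction E generalizing W with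
  | ex E ih =>
    simp only [bind]
    rw [ih _ _ (liftSubst_congr (p := fun x => E.Occurs x) h)]
  | conj E₁ E₂ ih₁ ih₂ =>
    simp only [bind]
    rw [ih₁ _ _ fun x hx => h x (.inl hx), ih₂ _ _ fun x hx => h x (.inr hx)]
  | _ =>
    simp only [bind]
    rw [(Term.bind_eq_bind_iff _ _ _).2 fun x hx => h x (.inl hx),
      (Term.bind_eq_bind_iff _ _ _).2 fun x hx => h x (.inr hx)]

theorem bind_var {V : Type} (E : EqConstraint S V) : E.bind Term.var = E := by
  induction E with
  | ex E ih => simp only [bind, liftSubst_var, ih]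
  | conj E₁ E₂ ih₁ ih₂ => simp only [bind, ih₁, ih₂]
  | _ => simp only [bind, Term.bind_var]

theorem inst_bind {V W : Type} (E : EqConstraint S (Option V)) (t : Term S V)
    (σ : V → Term S W) :
    (E.inst t).bind σ = (E.bind (liftSubst σ)).inst (t.bind σ) := by
  simp only [inst, bind_bind, openSubst_bind]

theorem exists_occurs_of_occurs_bind {V W : Type} (E : EqConstraint S V) (σ : V → Term S W)
    (x : W) (h : (E.bind σ).Occurs x) : ∃ y, E.Occurs y ∧ (σ y).Occurs x := by
  induction E generalizing W with
  | ex E ih => exact occurs_liftSubst_some (p := fun y => E.Occurs y) (ih _ _ h)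
  | conj E₁ E₂ ih₁ ih₂ =>
    rcases h with h | h
    · exact (ih₁ _ _ h).imp fun y hy => ⟨.inl hy.1, hy.2⟩
    · exact (ih₂ _ _ h).imp fun y hy => ⟨.inr hy.1, hy.2⟩
  | _ =>
    rcases h with h | h
    · exact ((Term.occurs_bind_iff _ _ _).1 h).imp fun y hy => ⟨.inl hy.1, hy.2⟩
    · exact ((Term.occurs_bind_iff _ _ _).1 h).imp fun y hy => ⟨.inr hy.1, hy.2⟩

theorem occurs_inst {V : Type} {E : EqConstraint S (Option V)} {t : Term S V} {x : V}
    (h : (E.inst t).Occurs x) : E.Occurs (some x) ∨ t.Occurs x :=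
  occurs_openSubst (p := fun y => E.Occurs y) (exists_occurs_of_occurs_bind _ _ _ h)

end EqConstraint

namespace SetTerm

variable {S : Signature} {V W X Z Z' : Type}

theorem bind_bind (T : SetTerm S V Z) (σ : V → Term S W) (τ : W → Term S X) :
    (T.bind σ).bind τ = T.bind (fun x => (σ x).bind τ) := by
  cases T <;> simp [bind, Term.bind_bind]

theorem bind_var (T : SetTerm S V Z) : T.bind Term.var = T := by
  cases T <;> simp [bind, Term.bind_var]

theorem bind_congr (T : SetTerm S V Z) (σ τ : V → Term S W)
    (h : ∀ x, T.Occurs x → σ x = τ x) : T.bind σ = T.bind τ := by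
  cases T with
  | var z => rfl
  | lit ζ =>
    simp only [bind]
    rw [Multiset.map_congr rfl fun t ht =>
      (Term.bind_eq_bind_iff t σ τ).2 fun x hx => h x ⟨t, ht, hx⟩]

theorem exists_occurs_of_occurs_bind (T : SetTerm S V Z) (σ : V → Term S W) (x : W)
    (h : (T.bind σ).Occurs x) : ∃ y, T.Occurs y ∧ (σ y).Occurs x := by
  cases T with
  | var z => exact h.elim
  | lit ζ =>
    obtain ⟨t, ht, hx⟩ := h
    obtain ⟨u, hu, rfl⟩ := Multiset.mem_map.1 ht
    exact ((Term.occurs_bind_iff _ _ _).1 hx).imp fun y hy => ⟨⟨u, hu, hy.1⟩, hy.2⟩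

theorem sbind_bind (T : SetTerm S V Z) (τ : Z → SetTerm S V Z') (σ : V → Term S W) :
    (T.sbind τ).bind σ = (T.bind σ).sbind (fun z => (τ z).bind σ) := by
  cases T <;> rfl

theorem liftSet_bind (τ : Z → SetTerm S V Z') (σ : V → Term S W) :
    (fun z => (liftSet τ z).bind σ) = liftSet (fun z => (τ z).bind σ) := by
  funext z
  cases z with
  | none => rfl
  | some z => cases h : τ z <;> simp [liftSet, bind, h]

theorem bind_some_bind_liftSubst (τ : Z → SetTerm S V Z') (σ : V → Term S W) :
    (fun z => ((τ z).bind fun x => Term.var (some x)).bind (liftSubst σ)) =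
      fun z => ((τ z).bind σ).bind fun x => Term.var (some x) := by
  funext z
  simp only [bind_bind, Term.bind, liftSubst]
  rfl

theorem exists_occurs_liftSet {τ : Z → SetTerm S V Z'} {x : V}
    (h : ∃ z, (liftSet τ z).Occurs x) : ∃ z, (τ z).Occurs x := by
  obtain ⟨z, hz⟩ := h
  cases z with
  | none => exact hz.elim
  | some z =>
    refine ⟨z, ?_⟩
    cases h : τ z <;> simp only [liftSet, h] at hz <;> exact hz

theorem exists_occurs_bind_some {τ : Z → SetTerm S V Z'} {x : V}
    (h : ∃ z, ((τ z).bind fun y => Term.var (some y)).Occurs (some x)) :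
    ∃ z, (τ z).Occurs x := by
  obtain ⟨z, hz⟩ := h
  obtain ⟨y, hy, hx⟩ := exists_occurs_of_occurs_bind _ _ _ hz
  cases hx
  exact ⟨z, hy⟩

theorem occurs_sbind {T : SetTerm S V Z} {τ : Z → SetTerm S V Z'} {x : V}
    (h : (T.sbind τ).Occurs x) : T.Occurs x ∨ ∃ z, (τ z).Occurs x := by
  cases T with
  | var z => exact .inr ⟨z, h⟩
  | lit ζ => exact .inl h

end SetTerm

namespace Constraint

variable {S : Signature}

theorem bind_bind {V W X Z : Type} (C : Constraint S V Z) (σ : V → Term S W)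
    (τ : W → Term S X) : (C.bind σ).bind τ = C.bind (fun x => (σ x).bind τ) := by
  induction C generalizing W X with
  | conj C₁ C₂ ih₁ ih₂ => simp only [bind, ih₁, ih₂]
  | ex C ih => simp only [bind, ih, liftSubst_bind]
  | all T C ih => simp only [bind, ih, liftSubst_bind, SetTerm.bind_bind]
  | query o t r E C ih =>
    simp only [bind, ih, liftSubst_bind, EqConstraint.bind_bind, Term.bind_bind]
  | pred P ts => simp [bind, Term.bind_bind]
  | _ => simp only [bind, Term.bind_bind, SetTerm.bind_bind]

theorem bind_var {V Z : Type} (C : Constraint S V Z) : C.bind Term.var = C := by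
  induction C with
  | conj C₁ C₂ ih₁ ih₂ => simp only [bind, ih₁, ih₂]
  | ex C ih => simp only [bind, ih, liftSubst_var]
  | all T C ih => simp only [bind, ih, liftSubst_var, SetTerm.bind_var]
  | query o t r E C ih =>
    simp only [bind, ih, liftSubst_var, EqConstraint.bind_var, Term.bind_var]
  | pred P ts => simp [bind, Term.bind_var]
  | _ => simp only [bind, Term.bind_var, SetTerm.bind_var]

theorem bind_congr {V W Z : Type} (C : Constraint S V Z) (σ τ : V → Term S W)
    (h : ∀ x, C.Occurs x → σ x = τ x) : C.bind σ = C.bind τ := by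
  induction C generalizing W with
  | emp => rfl
  | fls => rfl
  | conj C₁ C₂ ih₁ ih₂ =>
    simp only [bind]
    rw [ih₁ _ _ fun x hx => h x (.inl hx), ih₂ _ _ fun x hx => h x (.inr hx)]
  | ex C ih =>
    simp only [bind]
    rw [ih _ _ (liftSubst_congr (p := fun x => C.Occurs x) h)]
  | single t T =>
    simp only [bind]
    rw [(Term.bind_eq_bind_iff _ _ _).2 fun x hx => h x (.inl hx),
      SetTerm.bind_congr _ _ _ fun x hx => h x (.inr hx)]
  | all T C ih =>
    simp only [bind]
    rw [SetTerm.bind_congr _ _ _ fun x hx => h x (.inl hx),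
      ih _ _ (liftSubst_congr (p := fun x => C.Occurs x) fun x hx => h x (.inr hx))]
  | query o t r E C ih =>
    simp only [bind]
    rw [(Term.bind_eq_bind_iff _ _ _).2 fun x hx => h x (.inl hx),
      EqConstraint.bind_congr _ _ _
        (liftSubst_congr (p := fun x => E.Occurs x) fun x hx => h x (.inr (.inl hx))),
      ih _ _ fun x hx => h x (.inr (.inr hx))]
  | pred P ts =>
    simp only [bind]
    rw [List.map_congr_left fun t ht =>
      (Term.bind_eq_bind_iff t σ τ).2 fun x hx => h x ⟨t, ht, hx⟩]
  | _ =>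
    simp only [bind]
    rw [(Term.bind_eq_bind_iff _ _ _).2 fun x hx => h x (.inl hx),
      (Term.bind_eq_bind_iff _ _ _).2 fun x hx => h x (.inr hx)]

theorem inst_bind {V W Z : Type} (C : Constraint S (Option V) Z) (t : Term S V)
    (σ : V → Term S W) :
    (C.inst t).bind σ = (C.bind (liftSubst σ)).inst (t.bind σ) := by
  simp only [inst, bind_bind, openSubst_bind]

theorem exists_occurs_of_occurs_bind {V W Z : Type} (C : Constraint S V Z) (σ : V → Term S W)
    (x : W) (h : (C.bind σ).Occurs x) : ∃ y, C.Occurs y ∧ (σ y).Occurs x := by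
  induction C generalizing W with
  | emp => exact h.elim
  | fls => exact h.elim
  | conj C₁ C₂ ih₁ ih₂ =>
    rcases h with h | h
    · exact (ih₁ _ _ h).imp fun y hy => ⟨.inl hy.1, hy.2⟩
    · exact (ih₂ _ _ h).imp fun y hy => ⟨.inr hy.1, hy.2⟩
  | ex C ih => exact occurs_liftSubst_some (p := fun y => C.Occurs y) (ih _ _ h)
  | single t T =>
    rcases h with h | h
    · exact ((Term.occurs_bind_iff _ _ _).1 h).imp fun y hy => ⟨.inl hy.1, hy.2⟩
    · exact (SetTerm.exists_occurs_of_occurs_bind _ _ _ h).imp fun y hy => ⟨.inr hy.1, hy.2⟩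
  | all T C ih =>
    rcases h with h | h
    · exact (SetTerm.exists_occurs_of_occurs_bind _ _ _ h).imp fun y hy => ⟨.inl hy.1, hy.2⟩
    · exact (occurs_liftSubst_some (p := fun y => C.Occurs y) (ih _ _ h)).imp
        fun y hy => ⟨.inr hy.1, hy.2⟩
  | query o t r E C ih =>
    rcases h with h | h | h
    · exact ((Term.occurs_bind_iff _ _ _).1 h).imp fun y hy => ⟨.inl hy.1, hy.2⟩
    · exact (occurs_liftSubst_some (p := fun y => E.Occurs y)
        (EqConstraint.exists_occurs_of_occurs_bind _ _ _ h)).imp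
          fun y hy => ⟨.inr (.inl hy.1), hy.2⟩
    · exact (ih _ _ h).imp fun y hy => ⟨.inr (.inr hy.1), hy.2⟩
  | pred P ts =>
    obtain ⟨t, ht, hx⟩ := h
    obtain ⟨u, hu, rfl⟩ := List.mem_map.1 ht
    exact ((Term.occurs_bind_iff _ _ _).1 hx).imp fun y hy => ⟨⟨u, hu, hy.1⟩, hy.2⟩
  | _ =>
    rcases h with h | h
    · exact ((Term.occurs_bind_iff _ _ _).1 h).imp fun y hy => ⟨.inl hy.1, hy.2⟩
    · exact ((Term.occurs_bind_iff _ _ _).1 h).imp fun y hy => ⟨.inr hy.1, hy.2⟩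

theorem occurs_inst {V Z : Type} {C : Constraint S (Option V) Z} {t : Term S V} {x : V}
    (h : (C.inst t).Occurs x) : C.Occurs (some x) ∨ t.Occurs x :=
  occurs_openSubst (p := fun y => C.Occurs y) (exists_occurs_of_occurs_bind _ _ _ h)

theorem sbind_bind {V W Z Z' : Type} (C : Constraint S V Z) (τ : Z → SetTerm S V Z')
    (σ : V → Term S W) :
    (C.sbind τ).bind σ = (C.bind σ).sbind (fun z => (τ z).bind σ) := by
  induction C generalizing W Z' with
  | conj C₁ C₂ ih₁ ih₂ => simp only [bind, sbind, ih₁, ih₂]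
  | ex C ih => simp only [bind, sbind, ih, SetTerm.bind_some_bind_liftSubst]
  | all T C ih =>
    simp only [bind, sbind, ih, SetTerm.bind_some_bind_liftSubst, SetTerm.sbind_bind]
  | query o t r E C ih => simp only [bind, sbind, ih, SetTerm.liftSet_bind]
  | single t T => simp only [bind, sbind, SetTerm.sbind_bind]
  | _ => simp only [bind, sbind]

/-- Lets an answer be plugged into a continuation before or after variables are instantiated, as
solver and model do in different orders. -/
theorem instSet_bind {V W Z : Type} (C : Constraint S V (Option Z))
    (ζ : Multiset (Term S V)) (σ : V → Term S W) :
    (C.instSet ζ).bind σ = (C.bind σ).instSet (ζ.map fun t => t.bind σ) := by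
  rw [instSet, sbind_bind, instSet]
  congr 1
  funext z
  cases z <;> rfl

theorem occurs_sbind {V Z Z' : Type} {C : Constraint S V Z} {τ : Z → SetTerm S V Z'} {x : V}
    (h : (C.sbind τ).Occurs x) : C.Occurs x ∨ ∃ z, (τ z).Occurs x := by
  induction C generalizing Z' with
  | conj C₁ C₂ ih₁ ih₂ =>
    rcases h with h | h
    · exact (ih₁ h).imp_left .inl
    · exact (ih₂ h).imp_left .inr
  | ex C ih => exact (ih h).imp_right SetTerm.exists_occurs_bind_some
  | single t T =>
    rcases h with h | h
    · exact .inl (.inl h)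
    · exact (SetTerm.occurs_sbind h).imp_left .inr
  | all T C ih =>
    rcases h with h | h
    · exact (SetTerm.occurs_sbind h).imp_left .inl
    · exact (ih h).imp .inr SetTerm.exists_occurs_bind_some
  | query o t r E C ih =>
    rcases h with h | h | h
    · exact .inl (.inl h)
    · exact .inl (.inr (.inl h))
    · exact (ih h).imp (fun h => .inr (.inr h)) SetTerm.exists_occurs_liftSet
  | _ => exact .inl h

theorem occurs_instSet {V Z : Type} {C : Constraint S V (Option Z)} {ζ : Multiset (Term S V)}
    {x : V} (h : (C.instSet ζ).Occurs x) : C.Occurs x ∨ ∃ t ∈ ζ, t.Occurs x := by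
  refine (occurs_sbind h).imp_right ?_
  rintro ⟨_ | z, hz⟩
  · exact hz
  · exact hz.elim

end Constraint

/-- Paths consist of scopes and labels only, hence query answers are immune to later substitutions.
-/
theorem isGround_pathTerm {S : Signature} (s : Scope) (p : List (S.Label × Scope)) :
    (pathTerm s p).IsGround := by
  induction p generalizing s with
  | nil => rintro x ⟨i, hi⟩; fin_cases i; exact hi
  | cons a p ih =>
    rintro x ⟨i, hi⟩
    fin_cases i
    · exact hi
    · exact hi
    · exact ih _ x hi

/-! ## Declarative satisfaction in a final scope graph -/

variable {S : Signature}

/-- The reachable paths whose target satisfies `E` and that are not shadowed. -/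
def visiblePaths (G : Graph S) (o : PartialOrder S.Label) (s : Scope)
    (r : RegularExpression S.Label) (E : EqConstraint S (Option Var)) :
    Set (List (S.Label × Scope)) :=
  {p | (Reaches G s r p ∧ Holds G.data (E.inst (.scope (pathTgt s p)))) ∧
    ¬ ∃ p', (Reaches G s r p' ∧ Holds G.data (E.inst (.scope (pathTgt s p')))) ∧
      WordLT o (p'.map Prod.fst) (p.map Prod.fst)}

/-- What a derivation consumes: the scopes it creates, the edges it asserts, and its size. -/
abbrev Resources (S : Signature) : Type :=
  Multiset Scope × Multiset (Scope × S.Label × Scope) × ℕ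

/-- The resources of an inference that touches neither scopes nor edges. -/
def Resources.tick : Resources S := (0, 0, 1)

/-- In the final graph `G`, the constraint holds if the constraints `cs` do; this inference
consumes the given resources. -/
inductive Unfold (𝕊 : Spec S) (G : Graph S) :
    Constraint S Var Empty → Multiset (Constraint S Var Empty) → Resources S → Prop
  | emp : Unfold 𝕊 G .emp 0 .tick
  | conj (C₁ C₂ : Constraint S Var Empty) : Unfold 𝕊 G (.conj C₁ C₂) {C₁, C₂} .tick
  | ex (C : Constraint S (Option Var) Empty) (t : Term S Var) :
      Unfold 𝕊 G (.ex C) {C.inst t} .tick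
  | single (t t' : Term S Var) : Unfold 𝕊 G (.single t (.lit {t'})) {.eq t t'} .tick
  | all (ζ : Multiset (Term S Var)) (C : Constraint S (Option Var) Empty) :
      Unfold 𝕊 G (.all (.lit ζ) C) (ζ.map fun t => C.inst t) .tick
  | new (s : Scope) (t : Term S Var) :
      G.data s = some t → Unfold 𝕊 G (.new (.scope s) t) 0 ({s}, 0, 1)
  | edge (s₁ : Scope) (l : S.Label) (s₂ : Scope) :
      Unfold 𝕊 G (.edge (.scope s₁) l (.scope s₂)) 0 (0, {(s₁, l, s₂)}, 1)
  | query (o : PartialOrder S.Label) (s : Scope) (r : RegularExpression S.Label)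
      (E : EqConstraint S (Option Var)) (C : Constraint S Var (Option Empty))
      (ζ : Multiset (Term S Var)) :
      ζ.Nodup → (∀ t, t ∈ ζ ↔ ∃ p ∈ visiblePaths G o s r E, pathTerm s p = t) →
      Unfold 𝕊 G (.query o (.scope s) r E C) {C.instSet ζ} .tick
  | eq (t : Term S Var) : Unfold 𝕊 G (.eq t t) 0 .tick
  | dataOf (s : Scope) (t t' : Term S Var) :
      G.data s = some t' → Unfold 𝕊 G (.dataOf (.scope s) t) {.eq t t'} .tick
  | pred (R : Rule S) (τ : Fin R.k → Term S Var) : R ∈ 𝕊.rules →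
      Unfold 𝕊 G (.pred R.pred (R.head.map fun t => t.bind τ)) {R.body.bind τ} .tick

/-- The constraint holds in the final graph `G`, by a derivation with resources `r`. -/
inductive Sat (𝕊 : Spec S) (G : Graph S) : Constraint S Var Empty → Resources S → Prop
  | mk (C : Constraint S Var Empty) (cs : Multiset (Constraint S Var Empty)) (c : Resources S)
      (M : Multiset (Constraint S Var Empty × Resources S)) (r : Resources S) :
      Unfold 𝕊 G C cs c → M.map Prod.fst = cs → (∀ d ∈ M, Sat 𝕊 G d.1 d.2) →
      r = c + (M.map Prod.snd).sum → Sat 𝕊 G C r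

/-- All the constraints hold in `G`, by derivations with total resources `r`. -/
def SatAll (𝕊 : Spec S) (G : Graph S) (cs : Multiset (Constraint S Var Empty))
    (r : Resources S) : Prop :=
  ∃ M : Multiset (Constraint S Var Empty × Resources S),
    M.map Prod.fst = cs ∧ (∀ d ∈ M, Sat 𝕊 G d.1 d.2) ∧ r = (M.map Prod.snd).sum

section

variable {𝕊 : Spec S} {G : Graph S}

theorem sat_iff {C : Constraint S Var Empty} {r : Resources S} :
    Sat 𝕊 G C r ↔ ∃ cs c r', Unfold 𝕊 G C cs c ∧ SatAll 𝕊 G cs r' ∧ r = c + r' := by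
  constructor
  · rintro ⟨_, cs, c, M, _, hu, hM, hs, rfl⟩
    exact ⟨cs, c, _, hu, ⟨M, hM, hs, rfl⟩, rfl⟩
  · rintro ⟨cs, c, _, hu, ⟨M, hM, hs, rfl⟩, rfl⟩
    exact ⟨C, cs, c, M, _, hu, hM, hs, rfl⟩

theorem SatAll.zero : SatAll 𝕊 G 0 0 := ⟨0, by simp⟩

theorem SatAll.add {cs₁ cs₂ : Multiset (Constraint S Var Empty)} {r₁ r₂ : Resources S}
    (h₁ : SatAll 𝕊 G cs₁ r₁) (h₂ : SatAll 𝕊 G cs₂ r₂) :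
    SatAll 𝕊 G (cs₁ + cs₂) (r₁ + r₂) := by
  obtain ⟨M₁, rfl, hs₁, rfl⟩ := h₁
  obtain ⟨M₂, rfl, hs₂, rfl⟩ := h₂
  refine ⟨M₁ + M₂, by simp, fun d hd => ?_, by simp⟩
  exact (Multiset.mem_add.1 hd).elim (hs₁ d) (hs₂ d)

theorem satAll_cons_iff {C : Constraint S Var Empty} {cs : Multiset (Constraint S Var Empty)}
    {r : Resources S} :
    SatAll 𝕊 G (C ::ₘ cs) r ↔ ∃ r₁ r₂, Sat 𝕊 G C r₁ ∧ SatAll 𝕊 G cs r₂ ∧ r = r₁ + r₂ := by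
  classical
  constructor
  · rintro ⟨M, hM, hs, rfl⟩
    obtain ⟨d, hd, rfl, hM'⟩ := (Multiset.map_eq_cons _ _ _ _).2 hM
    obtain ⟨M', rfl⟩ := Multiset.exists_cons_of_mem hd
    rw [Multiset.erase_cons_head] at hM'
    exact ⟨d.2, _, hs d hd, ⟨M', hM', fun d' h => hs d' (Multiset.mem_cons_of_mem h), rfl⟩,
      by simp⟩
  · rintro ⟨r₁, _, h, ⟨M, rfl, hs, rfl⟩, rfl⟩
    refine ⟨(C, r₁) ::ₘ M, by simp, fun d hd => ?_, by simp⟩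
    rcases Multiset.mem_cons.1 hd with rfl | hd
    · exact h
    · exact hs d hd

theorem satAll_add_iff {cs₁ cs₂ : Multiset (Constraint S Var Empty)} {r : Resources S} :
    SatAll 𝕊 G (cs₁ + cs₂) r ↔
      ∃ r₁ r₂, SatAll 𝕊 G cs₁ r₁ ∧ SatAll 𝕊 G cs₂ r₂ ∧ r = r₁ + r₂ := by
  refine ⟨fun h => ?_, fun ⟨_, _, h₁, h₂, h⟩ => h ▸ h₁.add h₂⟩
  induction cs₁ using Multiset.induction generalizing r with
  | empty => exact ⟨0, r, .zero, by simpa using h, by simp⟩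
  | cons C cs ih =>
    rw [Multiset.cons_add] at h
    obtain ⟨r₁, _, hC, h', rfl⟩ := satAll_cons_iff.1 h
    obtain ⟨r₂, r₃, h₂, h₃, rfl⟩ := ih h'
    exact ⟨r₁ + r₂, r₃, satAll_cons_iff.2 ⟨_, _, hC, h₂, rfl⟩, h₃, (add_assoc ..).symm⟩

/-- The form that matches the solver: one inference at the head constraint replaces it by its
premises in the multiset and pays the cost `c`. -/
theorem satAll_cons_iff_unfold {C : Constraint S Var Empty}
    {cs : Multiset (Constraint S Var Empty)} {r : Resources S} :
    SatAll 𝕊 G (C ::ₘ cs) r ↔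
      ∃ cs' c r', Unfold 𝕊 G C cs' c ∧ SatAll 𝕊 G (cs' + cs) r' ∧ r = c + r' := by
  simp only [satAll_cons_iff, sat_iff, satAll_add_iff]
  constructor
  · rintro ⟨_, r₂, ⟨cs', c, r₁, hu, h₁, rfl⟩, h₂, rfl⟩
    exact ⟨cs', c, _, hu, ⟨r₁, r₂, h₁, h₂, rfl⟩, add_assoc ..⟩
  · rintro ⟨cs', c, _, hu, ⟨r₁, r₂, h₁, h₂, rfl⟩, rfl⟩
    exact ⟨_, r₂, ⟨cs', c, r₁, hu, h₁, rfl⟩, h₂, (add_assoc ..).symm⟩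

/-! ### Scopes and edges that a derivation accounts for -/

theorem mem_sum_fst {α : Type 1} {M : Multiset (α × Resources S)} {s : Scope} :
    s ∈ (M.map Prod.snd).sum.1 ↔ ∃ d ∈ M, s ∈ d.2.1 := by
  induction M using Multiset.induction with
  | empty => simp
  | cons d M ih => simp [ih]

theorem mem_sum_snd {α : Type 1} {M : Multiset (α × Resources S)}
    {e : Scope × S.Label × Scope} :
    e ∈ (M.map Prod.snd).sum.2.1 ↔ ∃ d ∈ M, e ∈ d.2.2.1 := by
  induction M using Multiset.induction with
  | empty => simp
  | cons d M ih => simp [ih]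

/-- A scope that a constraint asserts to be created is among the created ones. -/
theorem Sat.mem_of_creates {C : Constraint S Var Empty} {r : Resources S} (h : Sat 𝕊 G C r) :
    ∀ {V : Type} (C' : Constraint S V Empty) (σ : V → Term S Var) (x : V) (s : Scope),
      C'.bind σ = C → C'.Creates x → σ x = .scope s → s ∈ r.1 := by
  induction h with
  | mk C cs c M r hu hM _ hr ih =>
    subst hM hr
    intro V C' σ x s hC hx hσ
    -- `Creates` looks for a variable, which is gone once `σ` has put a scope in its place. The
    -- induction therefore tracks the uninstantiated `C'`, over any variable type because the body
    -- below a binder has one variable more.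
    have key : ∀ {W : Type} (C' : Constraint S W Empty) (σ : W → Term S Var) (x : W),
        C'.bind σ ∈ M.map Prod.fst → C'.Creates x → σ x = .scope s →
          s ∈ (c + (M.map Prod.snd).sum).1 := by
      intro W C' σ x h hx hσ
      obtain ⟨d, hd, he⟩ := Multiset.mem_map.1 h
      exact Multiset.mem_add.2 (.inr (mem_sum_fst.2 ⟨d, hd, ih d hd C' σ x s he.symm hx hσ⟩))
    cases C' with
    | conj C₁ C₂ =>
      subst hC
      generalize hcs : M.map Prod.fst = cs at hu key
      cases hu
      rcases hx with hx | hx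
      · exact key C₁ σ x (by simp) hx hσ
      · exact key C₂ σ x (by simp) hx hσ
    | ex C' =>
      subst hC
      generalize hcs : M.map Prod.fst = cs at hu key
      cases hu with
      | ex _ t =>
        refine key C' (fun y => (liftSubst σ y).bind (openSubst t)) (some x) ?_ hx ?_
        · simp [Constraint.inst, Constraint.bind_bind]
        · simp [liftSubst, hσ, Term.map, Term.bind]
    | new t₁ t₂ =>
      cases t₁ with
      | var y =>
        cases hx
        simp only [Constraint.bind, Term.bind, hσ] at hC
        subst hC
        generalize M.map Prod.fst = cs at hu
        cases hu
        simp
      | _ => exact hx.elim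
    | _ => exact hx.elim

/-- An edge asserted by a derivation that creates no scope of `N` is supported. -/
theorem Sat.supports {N : Set Scope} {C : Constraint S Var Empty} {r : Resources S}
    (h : Sat 𝕊 G C r) {s₁ : Scope} {l : S.Label} {s₂ : Scope} :
    (∀ s ∈ r.1, s ∉ N) → (s₁, l, s₂) ∈ r.2.1 → Supports 𝕊 N s₁ l C := by
  induction h with
  | mk C cs c M r hu hM hs hr ih =>
    subst hr
    intro hN he
    have key : (s₁, l, s₂) ∈ c.2.1 ∨ ∃ C' ∈ cs, Supports 𝕊 N s₁ l C' := by
      refine (Multiset.mem_add.1 he).imp_right fun he => ?_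
      obtain ⟨d, hd, he⟩ := mem_sum_snd.1 he
      refine ⟨d.1, hM ▸ Multiset.mem_map_of_mem _ hd, ih d hd (fun s hs => hN s ?_) he⟩
      exact Multiset.mem_add.2 (.inr (mem_sum_fst.2 ⟨d, hd, hs⟩))
    cases hu with
    | ex C t =>
      simp only [Resources.tick, Multiset.notMem_zero, false_or, Multiset.mem_singleton,
        exists_eq_left] at key
      -- Side condition of support: if the witness were a scope of `N` that the body creates, that
      -- scope would be among the resources, contrary to `hN`.
      refine .ex C t (fun s' hs' ht hC => ?_) key
      subst ht
      obtain ⟨d, hd, hd'⟩ := Multiset.mem_map.1 (hM ▸ Multiset.mem_singleton_self _)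
      have := (hs d hd).mem_of_creates C (openSubst (.scope s')) none s' hd'.symm hC rfl
      exact hN s' (Multiset.mem_add.2 (.inr (mem_sum_fst.2 ⟨d, hd, this⟩))) hs'
    | conj C₁ C₂ =>
      simp only [Resources.tick, Multiset.notMem_zero, false_or, Multiset.insert_eq_cons,
        Multiset.mem_cons, Multiset.mem_singleton, exists_eq_or_imp, exists_eq_left] at key
      exact key.elim (.left _ _) (.right _ _)
    | edge s₃ l' s₄ =>
      simp only [Multiset.mem_singleton, Prod.mk.injEq, Multiset.notMem_zero, false_and,
        exists_false, or_false] at key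
      obtain ⟨rfl, rfl, rfl⟩ := key
      exact .edge _
    | all ζ C =>
      simp only [Resources.tick, Multiset.notMem_zero, false_or, Multiset.mem_map] at key
      obtain ⟨_, ⟨t, ht, rfl⟩, h⟩ := key
      exact .all ζ C t ht h
    | query o s r E C ζ =>
      simp only [Resources.tick, Multiset.notMem_zero, false_or, Multiset.mem_singleton,
        exists_eq_left] at key
      exact .query o _ r E C ζ key
    | pred R τ hR =>
      simp only [Resources.tick, Multiset.notMem_zero, false_or, Multiset.mem_singleton,
        exists_eq_left] at key
      exact .pred R τ hR key
    | single t t' =>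
      simp only [Resources.tick, Multiset.notMem_zero, false_or, Multiset.mem_singleton,
        exists_eq_left] at key
      cases key
    | dataOf s t t' h =>
      simp only [Resources.tick, Multiset.notMem_zero, false_or, Multiset.mem_singleton,
        exists_eq_left] at key
      cases key
    | _ => simp [Resources.tick] at key

theorem SatAll.exists_of_mem {cs : Multiset (Constraint S Var Empty)} {r : Resources S}
    (h : SatAll 𝕊 G cs r) {C : Constraint S Var Empty} (hC : C ∈ cs) :
    ∃ r', Sat 𝕊 G C r' ∧ ∀ s ∈ r'.1, s ∈ r.1 := by
  obtain ⟨M, rfl, hs, rfl⟩ := h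
  obtain ⟨d, hd, rfl⟩ := Multiset.mem_map.1 hC
  exact ⟨d.2, hs d hd, fun s h => mem_sum_fst.2 ⟨d, hd, h⟩⟩

theorem SatAll.exists_supports {N : Set Scope} {cs : Multiset (Constraint S Var Empty)}
    {r : Resources S} (h : SatAll 𝕊 G cs r) (hN : ∀ s ∈ r.1, s ∉ N) {s₁ : Scope}
    {l : S.Label} {s₂ : Scope} (he : (s₁, l, s₂) ∈ r.2.1) :
    ∃ C ∈ cs, Supports 𝕊 N s₁ l C := by
  obtain ⟨M, rfl, hs, rfl⟩ := h
  obtain ⟨d, hd, he⟩ := mem_sum_snd.1 he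
  exact ⟨d.1, Multiset.mem_map_of_mem _ hd,
    (hs d hd).supports (fun s h => hN s (mem_sum_fst.2 ⟨d, hd, h⟩)) he⟩

end

/-! ## Stability of query answers -/

/-- Equality constraints are positive, so instantiation and further data cannot destroy their truth.
This is the stable counterpart of `Refuted`, which is stable by definition. -/
theorem Holds.bind {ρ ρ' : Scope → Option (Term S Var)} {σ : Subst S}
    {E : EqConstraint S Var} (h : Holds ρ E)
    (hρ : ∀ s t, ρ s = some t → ρ' s = some (t.bind σ)) : Holds ρ' (E.bind σ) := by
  induction h with
  | eq t => exact .eq _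
  | dataOf s t h => exact .dataOf s _ (hρ s t h)
  | conj _ _ _ _ ih₁ ih₂ => exact .conj _ _ ih₁ ih₂
  | ex E t _ ih => exact .ex _ (t.bind σ) (by rwa [← EqConstraint.inst_bind])

/-- A walk that leaves the old graph is cut at its first new edge. -/
theorem isWalk_or_exists_new_edge {G G' : Graph S} {s : Scope} {p : List (S.Label × Scope)}
    (h : G'.IsWalk s p) : G.IsWalk s p ∨ ∃ q l s' p', p = q ++ (l, s') :: p' ∧ G.IsWalk s q ∧
      (pathTgt s q, l, s') ∈ G'.edges ∧ (pathTgt s q, l, s') ∉ G.edges := by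
  induction p generalizing s with
  | nil => exact .inl trivial
  | cons a p ih =>
    obtain ⟨l, s'⟩ := a
    by_cases he : (s, l, s') ∈ G.edges
    · rcases ih h.2 with hp | ⟨q, l', s'', p', rfl, hq, h₁, h₂⟩
      · exact .inl ⟨he, hp⟩
      · exact .inr ⟨(l, s') :: q, l', s'', p', rfl, ⟨he, hq⟩, h₁, h₂⟩
    · exact .inr ⟨[], l, s', p, rfl, trivial, h.1, he⟩

theorem Graph.IsWalk.mono {G G' : Graph S} (hG : G.edges ⊆ G'.edges) {s : Scope}
    {p : List (S.Label × Scope)} (h : G.IsWalk s p) : G'.IsWalk s p := by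
  induction p generalizing s with
  | nil => trivial
  | cons a p ih => exact ⟨hG h.1, ih h.2⟩

/-- If a matching path used a new edge, the part before the first one would be an old path whose
word, followed by the label of that edge, is a prefix of a matching word. The edge would be weakly
critical. -/
theorem reaches_iff_of_forall_not_weaklyCritical {G G' : Graph S} {s : Scope}
    {r : RegularExpression S.Label} (hG : G.edges ⊆ G'.edges)
    (h : ∀ s₁ l s₂, (s₁, l, s₂) ∈ G'.edges → (s₁, l, s₂) ∉ G.edges →
      ¬ WeaklyCritical G s r s₁ l) (p : List (S.Label × Scope)) :
    Reaches G s r p ↔ Reaches G' s r p := by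
  refine ⟨fun hp => ⟨⟨hp.1.1.mono hG, hp.1.2⟩, hp.2⟩, fun hp => ⟨⟨?_, hp.1.2⟩, hp.2⟩⟩
  rcases isWalk_or_exists_new_edge (G := G) hp.1.1 with hw | ⟨q, l, s', p', rfl, hq, h₁, h₂⟩
  · exact hw
  · refine (h _ _ _ h₁ h₂ ⟨q, p'.map Prod.fst, ⟨hq, ?_⟩, rfl, ?_⟩).elim
    -- A prefix of a path that visits no scope twice visits no scope twice.
    · have := hp.1.2
      rw [List.map_append, ← List.cons_append] at this
      exact this.of_append_left
    · simpa using hp.2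

/-! ## Models of configurations -/

/-- Under `σ`, the remaining constraints of `κ` hold in the final graph `G`, and `G` arises
from the graph of `κ` by the creation of scopes and edges that they assert. -/
structure Models (𝕊 : Spec S) (G : Graph S) (κ : Config S) (σ : Subst S) (r : Resources S) :
    Prop where
  sat : SatAll 𝕊 G (κ.cs.map fun C => C.bind σ) r
  nodup : r.1.Nodup
  fresh : ∀ s ∈ r.1, s ∉ κ.graph.nodes
  edges : ∀ e, e ∈ G.edges ↔ e ∈ κ.graph.edges ∨ e ∈ r.2.1
  data : ∀ s t, κ.graph.data s = some t → G.data s = some (t.bind σ)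

section

variable {𝕊 : Spec S} {G : Graph S} {σ : Subst S} {r : Resources S}

/-- Substitutions act on models by precomposition. For a most general unifier `θ` and a unifier `σ`,
`θ.comp σ = σ`, so the same instantiation then serves on both sides. -/
theorem models_iff_of_substTo {κ κ' : Config S} {θ : Subst S} (h : κ.SubstTo θ κ') :
    Models 𝕊 G κ' σ r ↔ Models 𝕊 G κ (θ.comp σ) r := by
  obtain ⟨hg, hc, -, -⟩ := h
  have e : κ'.cs.map (fun C => C.bind σ) = κ.cs.map fun C => C.bind (θ.comp σ) := by
    rw [hc, Multiset.map_map]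
    exact Multiset.map_congr rfl fun C _ => C.bind_bind θ σ
  constructor
  · rintro ⟨h₁, h₂, h₃, h₄, h₅⟩
    rw [e] at h₁
    rw [hg] at h₃ h₄ h₅
    refine ⟨h₁, h₂, h₃, h₄, fun s t hs => ?_⟩
    rw [h₅ s (t.bind θ) (by simp [Graph.subst, hs]), Term.bind_bind]
    rfl
  · rintro ⟨h₁, h₂, h₃, h₄, h₅⟩
    refine ⟨e ▸ h₁, h₂, by rwa [hg], by rwa [hg], fun s t hs => ?_⟩
    rw [hg] at hs
    simp only [Graph.subst, Option.map_eq_some_iff] at hs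
    obtain ⟨t, hs, rfl⟩ := hs
    rw [h₅ s t hs, Term.bind_bind]
    rfl

/-- A guarded query has the same visible paths in the present graph as in the final one. -/
theorem mem_visiblePaths_iff_of_guard {G₀ : Graph S} {o : PartialOrder S.Label} {s : Scope}
    {q : RegularExpression S.Label} {E : EqConstraint S (Option Var)}
    {C : Constraint S Var (Option Empty)} {cs : Multiset (Constraint S Var Empty)}
    {A : Set (List (S.Label × Scope))} {ζ : Multiset (Term S Var)}
    (hA : IsAnswer G₀ o s q E A) (hg : Guard 𝕊 G₀ o s q E C cs)
    (hs : SatAll 𝕊 G ((C.bind σ).instSet ζ ::ₘ cs.map fun C => C.bind σ) r)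
    (hf : ∀ s ∈ r.1, s ∉ G₀.nodes) (he : ∀ e, e ∈ G.edges ↔ e ∈ G₀.edges ∨ e ∈ r.2.1)
    (hd : ∀ s t, G₀.data s = some t → G.data s = some (t.bind σ))
    (p : List (S.Label × Scope)) :
    p ∈ visiblePaths G o s q (E.bind (liftSubst σ)) ↔ p ∈ A := by
  have hr : ∀ p, Reaches G₀ s q p ↔ Reaches G s q p := by
    refine reaches_iff_of_forall_not_weaklyCritical (fun e h => (he e).2 (.inl h)) ?_
    intro s₁ l s₂ h₁ h₂ hw
    have h₃ := ((he _).1 h₁).resolve_left h₂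
    -- The model's own `σ` witnesses that the edge may still be added. It respects the restriction
    -- in `MayExtend`: a scope still to be created is among the resources and hence new.
    refine hg s₁ l hw ⟨σ, fun x s' hs' hx C' hC' hcr => ?_, ?_⟩
    · rcases Multiset.mem_cons.1 hC' with rfl | hC'
      · exact hcr.elim
      · obtain ⟨r', hr', hsub⟩ := hs.exists_of_mem
          (Multiset.mem_cons_of_mem (Multiset.mem_map_of_mem (fun C => C.bind σ) hC'))
        exact hf s' (hsub s' (hr'.mem_of_creates C' σ x s' rfl hcr hx)) hs'
    · obtain ⟨C', hC', hsup⟩ := hs.exists_supports hf h₃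
      rcases Multiset.mem_cons.1 hC' with rfl | hC'
      -- Support of a query allows any answer, in particular the actual one.
      · exact ⟨_, Multiset.mem_cons_self _ _, .query _ _ _ _ _ ζ hsup⟩
      · obtain ⟨C', hC'', rfl⟩ := Multiset.mem_map.1 hC'
        exact ⟨C', Multiset.mem_cons_of_mem hC'', hsup⟩
  have hh : ∀ p, Reaches G₀ s q p ∧ Holds G₀.data (E.inst (.scope (pathTgt s p))) ↔
      Reaches G s q p ∧ Holds G.data ((E.bind (liftSubst σ)).inst (.scope (pathTgt s p))) := by
    intro p
    rw [← hr]
    refine and_congr_right fun hp => ?_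
    have e : (E.bind (liftSubst σ)).inst (.scope (pathTgt s p)) =
        (E.inst (.scope (pathTgt s p))).bind σ := by
      rw [EqConstraint.inst_bind]
      rfl
    rw [e]
    -- Conversely, a condition that holds in the final graph is not refuted now, so by definedness
    -- of the answer it already holds.
    refine ⟨fun h => h.bind hd, fun h => (hA.1 p hp).resolve_right fun hn => hn σ _ hd h⟩
  rw [hA.2]
  simp only [visiblePaths, Set.mem_ofPred_eq, hh]

end

variable {𝕊 : Spec S}

/-! ## Solver steps that follow a model -/

section

variable {G : Graph S} {σ : Subst S} {r : Resources S}

/-- The conditions on the graph see only the scopes and edges among the resources, and `σ` only on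
variables of the data. Hole maps, hole states and derivation sizes may change freely. -/
theorem Models.replace {κ : Config S} (h : Models 𝕊 G κ σ r)
    {cs : Multiset (Constraint S Var Empty)} {U : HoleMap} {H : HoleState S} {τ : Subst S}
    {r' : Resources S} (hs : SatAll 𝕊 G (cs.map fun C => C.bind τ) r') (h₁ : r'.1 = r.1)
    (h₂ : r'.2.1 = r.2.1)
    (hτ : ∀ x s t, κ.graph.data s = some t → t.Occurs x → σ x = τ x) :
    Models 𝕊 G ⟨κ.graph, cs, U, H⟩ τ r' where
  sat := hs
  nodup := h₁ ▸ h.nodup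
  fresh := h₁ ▸ h.fresh
  edges := h₂ ▸ h.edges
  data s t ht := by
    rw [h.data s t ht, (Term.bind_eq_bind_iff t σ τ).2 fun x hx => hτ x s t ht hx]

theorem map_bind_congr {cs : Multiset (Constraint S Var Empty)} {σ τ : Subst S}
    (h : ∀ C ∈ cs, ∀ x, C.Occurs x → σ x = τ x) :
    (cs.map fun C => C.bind σ) = cs.map fun C => C.bind τ :=
  Multiset.map_congr rfl fun C hC => C.bind_congr σ τ (h C hC)

theorem Config.SubstTo.eq_none {κ κ' : Config S} {θ : Subst S} (h : κ.SubstTo θ κ')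
    (hU : κ.U = fun _ => none) (hH : κ.H = fun _ => none) :
    κ'.U = (fun _ => none) ∧ κ'.H = fun _ => none := by
  obtain ⟨-, -, ⟨-, h₁⟩, h₂⟩ := h
  constructor
  · funext y
    refine Option.eq_none_iff_forall_ne_some.2 fun h hy => ?_
    simpa [hU] using h₁ y h hy
  · rw [h₂, hH]
    rfl

/-- Without holes no variable can become related to two of them, so a substitution never blocks a
step. -/
theorem substTo_none (G : Graph S) (cs : Multiset (Constraint S Var Empty)) (θ : Subst S) :
    Config.SubstTo ⟨G, cs, fun _ => none, fun _ => none⟩ θ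
      ⟨G.subst θ, cs.map fun C => C.bind θ, fun _ => none, fun _ => none⟩ :=
  ⟨rfl, rfl, by simp [HoleMap.SubstTo], rfl⟩

/-- The step of a configuration to one with a smaller derivation in the same model. -/
def Descends (𝕊 : Spec S) (G : Graph S) (κ : Config S) (n : ℕ) : Prop :=
  ∃ κ' σ' r', Step 𝕊 κ κ' ∧ κ'.U = (fun _ => none) ∧ (κ'.H = fun _ => none) ∧
    Models 𝕊 G κ' σ' r' ∧ r'.2.2 < n

/-- The same solver rule is applied to the same constraint, with its free choices dictated by the
model; it strips the last inference from the derivation of that constraint. A rejecting rule cannot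
apply, since the rejected constraint would have no derivation. -/
theorem Models.descends_of_step {κ κ₁ : Config S} (h : Models 𝕊 G κ σ r)
    (hstep : Step 𝕊 κ κ₁) (hU : κ.U = fun _ => none) (hH : κ.H = fun _ => none) :
    Descends 𝕊 G κ r.2.2 := by
  have hm := h
  obtain ⟨hs, hn, hf, he, hd⟩ := h
  cases hstep with
  | conj G₀ C₁ C₂ cs U H =>
    rw [Multiset.map_cons, satAll_cons_iff_unfold] at hs
    obtain ⟨cs', c, r', hu, hs, rfl⟩ := hs
    cases hu
    refine ⟨_, σ, r', .conj G₀ C₁ C₂ cs U H, hU, hH,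
      hm.replace (by simpa using hs) ?_ ?_ fun _ _ _ _ _ => rfl, ?_⟩ <;> simp [Resources.tick]
  | emp G₀ cs U H =>
    rw [Multiset.map_cons, satAll_cons_iff_unfold] at hs
    obtain ⟨cs', c, r', hu, hs, rfl⟩ := hs
    cases hu
    refine ⟨_, σ, r', .emp G₀ cs U H, hU, hH,
      hm.replace (by simpa using hs) ?_ ?_ fun _ _ _ _ _ => rfl, ?_⟩ <;> simp [Resources.tick]
  | ex G₀ C cs U H y hy =>
    rw [Multiset.map_cons, satAll_cons_iff_unfold] at hs
    obtain ⟨cs', c, r', hu, hs, rfl⟩ := hs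
    cases hu with
    | ex _ t =>
      -- The fresh variable is interpreted by the witness `t` of the derivation; nothing in use
      -- notices the change.
      have hag : ∀ x, x ≠ y → σ x = Function.update σ y t x := fun x hx => by simp [hx]
      have hne : ∀ x, Config.Uses ⟨G₀, .ex C ::ₘ cs, U, H⟩ x → σ x = Function.update σ y t x :=
        fun x hx => hag x fun e => hy (e ▸ hx)
      refine ⟨_, Function.update σ y t, r', .ex G₀ C cs U H y hy, hU, hH,
        hm.replace ?_ ?_ ?_ fun x s t h₁ h₂ => hne x (.inl ⟨s, t, h₁, h₂⟩), ?_⟩ <;>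
        try simp [Resources.tick]
      have e₁ : (C.inst (.var y)).bind (Function.update σ y t) =
          (C.bind (liftSubst σ)).inst t := by
        rw [Constraint.inst_bind, Constraint.bind_congr C (liftSubst σ)
          (liftSubst (Function.update σ y t)) (liftSubst_congr (p := fun x => C.Occurs x)
            fun x hx => hne x (.inr (.inl ⟨_, Multiset.mem_cons_self _ _, hx⟩)))]
        simp [Term.bind]
      rw [e₁, ← map_bind_congr (σ := σ) fun C hC x hx =>
        hne x (.inr (.inl ⟨C, Multiset.mem_cons_of_mem hC, hx⟩))]
      simpa using hs
  | eq G₀ t₁ t₂ cs U H θ _ hθ hκ =>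
    rw [Multiset.map_cons, satAll_cons_iff_unfold] at hs
    obtain ⟨cs', c, r', hu, hs, rfl⟩ := hs
    have ht : t₁.bind σ = t₂.bind σ := by
      simp only [Constraint.bind] at hu
      generalize t₁.bind σ = u₁ at hu
      generalize t₂.bind σ = u₂ at hu
      cases hu
      rfl
    have hc : cs' = 0 ∧ c = .tick := by
      simp only [Constraint.bind] at hu
      generalize t₁.bind σ = u₁ at hu
      generalize t₂.bind σ = u₂ at hu
      cases hu
      exact ⟨rfl, rfl⟩
    obtain ⟨rfl, rfl⟩ := hc
    have hu := hκ.eq_none hU hH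
    refine ⟨κ₁, σ, r', .eq G₀ t₁ t₂ cs U H θ κ₁ hθ hκ, hu.1, hu.2,
      (models_iff_of_substTo hκ).2 ?_, ?_⟩
    · rw [hθ.2 σ (by simp [Unifies, ht])]
      refine hm.replace (by simpa using hs) ?_ ?_ fun _ _ _ _ _ => rfl <;> simp [Resources.tick]
    · simp [Resources.tick]
  | single G₀ t t' cs U H =>
    rw [Multiset.map_cons, satAll_cons_iff_unfold] at hs
    obtain ⟨cs', c, r', hu, hs, rfl⟩ := hs
    simp only [Constraint.bind, SetTerm.bind, Multiset.map_singleton] at hu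
    generalize hζ : ({t'.bind σ} : Multiset (Term S Var)) = ζ at hu
    cases hu
    rw [Multiset.singleton_inj] at hζ
    subst hζ
    refine ⟨_, σ, r', .single G₀ t t' cs U H, hU, hH,
      hm.replace (by simpa [Constraint.bind] using hs) ?_ ?_ fun _ _ _ _ _ => rfl, ?_⟩ <;>
      simp [Resources.tick]
  | all G₀ ζ C cs U H =>
    rw [Multiset.map_cons, satAll_cons_iff_unfold] at hs
    obtain ⟨cs', c, r', hu, hs, rfl⟩ := hs
    cases hu
    refine ⟨_, σ, r', .all G₀ ζ C cs U H, hU, hH,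
      hm.replace ?_ ?_ ?_ fun _ _ _ _ _ => rfl, ?_⟩ <;> try simp [Resources.tick]
    simpa [Function.comp_def, Constraint.inst_bind] using hs
  | newScope G₀ x t cs U H =>
    rw [Multiset.map_cons, satAll_cons_iff_unfold] at hs
    obtain ⟨cs', c, r', hu, hs, rfl⟩ := hs
    simp only [Constraint.bind, Term.bind] at hu
    generalize hx : σ x = u at hu
    cases hu with
    | new s _ hst =>
      dsimp only at hU hH
      subst hU hH
      simp only [Prod.fst_add, Multiset.singleton_add, Multiset.nodup_cons, Multiset.mem_cons,
        forall_eq_or_imp] at hn hf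
      -- The new scope is the one that the model assigns to `x`, not the one picked by the given
      -- step. Freshness of the resources makes it admissible, and their distinctness keeps the
      -- remaining ones fresh afterwards.
      refine ⟨_, σ, r', .newScope G₀ x t cs _ _ s _ hf.1 (substTo_none _ _ _), rfl, rfl,
        (models_iff_of_substTo (substTo_none _ _ _)).2 ?_, by simp⟩
      have e : Subst.comp (Subst.one x (.scope s)) σ = σ := by
        funext y
        by_cases hy : y = x
        · subst hy; simp [Subst.comp, Subst.one, Term.bind, hx]
        · simp [Subst.comp, Subst.one, Term.bind, hy]
      rw [e]
      refine ⟨by simpa using hs, hn.2, fun s' hs' => ?_,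
        fun e => by simpa [Graph.addNode] using he e, fun s' t' hs' => ?_⟩
      · rintro (rfl | h)
        · exact hn.1 hs'
        · exact hf.2 s' hs' h
      · by_cases h : s' = s
        · subst h
          simp only [Graph.addNode, Function.update_self, Option.some.injEq] at hs'
          subst hs'
          exact hst
        · simp only [Graph.addNode, Function.update_of_ne h] at hs'
          exact hd s' t' hs'
  | newEdge G₀ s₁ l s₂ cs U H =>
    rw [Multiset.map_cons, satAll_cons_iff_unfold] at hs
    obtain ⟨cs', c, r', hu, hs, rfl⟩ := hs
    cases hu
    refine ⟨_, σ, r', .newEdge G₀ s₁ l s₂ cs U H, hU, hH,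
      ⟨by simpa using hs, by simpa using hn, by simpa [Graph.addEdge] using hf,
        fun e => ?_, hd⟩, by simp⟩
    rw [he]
    simp [Graph.addEdge]
    tauto
  | data G₀ s t₁ t₂ cs U H hdata =>
    rw [Multiset.map_cons, satAll_cons_iff_unfold] at hs
    obtain ⟨cs', c, r', hu, hs, rfl⟩ := hs
    cases hu with
    | dataOf _ _ t' ht' =>
      have : t' = t₂.bind σ := Option.some.inj (ht'.symm.trans (hd s t₂ hdata))
      subst this
      refine ⟨_, σ, r', .data G₀ s t₁ t₂ cs U H hdata, hU, hH,
        hm.replace (by simpa [Constraint.bind] using hs) ?_ ?_ fun _ _ _ _ _ => rfl, ?_⟩ <;>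
        simp [Resources.tick]
  | query G₀ o s q E C cs U H A ζ hE hA hg hζ hζ' =>
    rw [Multiset.map_cons, satAll_cons_iff_unfold] at hs
    obtain ⟨cs', c, r', hu, hs, rfl⟩ := hs
    simp only [Constraint.bind, Term.bind] at hu
    cases hu with
    | query _ _ _ _ _ ζ' hn' hm' =>
      have hv := mem_visiblePaths_iff_of_guard hA hg (by simpa using hs)
        (by simpa [Resources.tick] using hf) (by simpa [Resources.tick] using he) hd
      -- The answer in the final graph, used by the derivation, is the answer that the solver
      -- computes now.
      have : ζ' = ζ := by
        refine (Multiset.Nodup.ext hn' hζ).2 fun t => ?_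
        rw [hm', hζ']
        simp only [hv]
      subst this
      have hgr : ζ'.map (fun t => t.bind σ) = ζ' := by
        conv_rhs => rw [← Multiset.map_id ζ']
        refine Multiset.map_congr rfl fun t ht => ?_
        obtain ⟨p, -, rfl⟩ := (hζ' t).1 ht
        exact (isGround_pathTerm s p).bind_eq σ
      refine ⟨_, σ, r', .query G₀ o s q E C cs U H A ζ' hE hA hg hζ hζ', hU, hH,
        hm.replace ?_ ?_ ?_ fun _ _ _ _ _ => rfl, ?_⟩ <;> try simp [Resources.tick]
      simpa [Constraint.instSet_bind, hgr] using hs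
  | pred G₀ P ts cs U H R v θ _ hR hP huniq hv hfresh hθ hκ =>
    rw [Multiset.map_cons, satAll_cons_iff_unfold] at hs
    obtain ⟨cs', c, r', hu, hs, rfl⟩ := hs
    simp only [Constraint.bind] at hu
    generalize hus : (ts.map fun t => t.bind σ) = us at hu
    cases hu with
    | pred R' τ hR' =>
      -- The rule used in the derivation matches the open arguments as well, so it is the only rule
      -- the solver can choose. Its instantiation `τ` then extends `σ` to the renamed rule
      -- variables.
      obtain rfl := huniq R' hR' ⟨rfl, σ, τ, hus⟩
      have hne : ∀ x, Config.Uses ⟨G₀, .pred R'.pred ts ::ₘ cs, U, H⟩ x →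
          σ x = Function.extend v τ σ x := fun x hx =>
        (Function.extend_apply' _ _ _ fun ⟨i, hi⟩ => hfresh i (hi ▸ hx)).symm
      have hvi : ∀ i, Function.extend v τ σ (v i) = τ i := fun i => hv.extend_apply _ _ _
      have hun : Unifies (Function.extend v τ σ) ts (R'.head.map fun t => t.map v) := by
        rw [Unifies, List.map_map, List.map_congr_left (g := fun t => t.bind σ), hus]
        · refine List.map_congr_left fun t _ => ?_
          simp [Term.map, Term.bind_bind, Term.bind, hvi]
        · intro t ht
          exact (Term.bind_eq_bind_iff _ _ _).2 fun x hx =>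
            (hne x (.inr (.inl ⟨_, Multiset.mem_cons_self _ _, t, ht, hx⟩))).symm
      have hu := hκ.eq_none hU hH
      refine ⟨κ₁, Function.extend v τ σ, r', .pred G₀ R'.pred ts cs U H R' v θ κ₁ hR rfl huniq hv
        hfresh hθ hκ, hu.1, hu.2, (models_iff_of_substTo hκ).2 ?_, by simp [Resources.tick]⟩
      rw [hθ.2 _ hun]
      refine hm.replace ?_ ?_ ?_ fun x s t h₁ h₂ => hne x (.inl ⟨s, t, h₁, h₂⟩) <;>
        try simp [Resources.tick]
      rw [← map_bind_congr (σ := σ) fun C hC x hx =>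
        hne x (.inr (.inl ⟨C, Multiset.mem_cons_of_mem hC, hx⟩))]
      simpa [Constraint.bind_bind, Term.bind, hvi] using hs
  | eqFail G₀ t₁ t₂ cs U H hne =>
    rw [Multiset.map_cons, satAll_cons_iff_unfold] at hs
    obtain ⟨cs', c, r', hu, hs, rfl⟩ := hs
    simp only [Constraint.bind] at hu
    generalize h₁ : t₁.bind σ = u₁ at hu
    generalize h₂ : t₂.bind σ = u₂ at hu
    cases hu
    exact (hne ⟨σ, by simp [Unifies, h₁, h₂]⟩).elim
  | singleFail G₀ t ζ cs U H hne =>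
    rw [Multiset.map_cons, satAll_cons_iff_unfold] at hs
    obtain ⟨cs', c, r', hu, hs, rfl⟩ := hs
    simp only [Constraint.bind, SetTerm.bind] at hu
    generalize hζ : (ζ.map fun t => t.bind σ) = ζ' at hu
    cases hu
    exact (hne (by rw [← Multiset.card_map (fun t => Term.bind t σ) ζ, hζ]; simp)).elim
  | predFail G₀ P ts cs U H hne =>
    rw [Multiset.map_cons, satAll_cons_iff_unfold] at hs
    obtain ⟨cs', c, r', hu, hs, rfl⟩ := hs
    simp only [Constraint.bind] at hu
    generalize hus : (ts.map fun t => t.bind σ) = us at hu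
    cases hu with
    | pred R τ hR => exact (hne ⟨R, hR, rfl, σ, τ, hus⟩).elim
  | falseFail G₀ cs U H _ =>
    rw [Multiset.map_cons, satAll_cons_iff_unfold] at hs
    obtain ⟨cs', c, r', hu, hs, rfl⟩ := hs
    cases hu

/-- A configuration with a model has an exhaustive run that stays within the model. -/
theorem Models.exists_exhaustive {κ : Config S} (h : Models 𝕊 G κ σ r)
    (hU : κ.U = fun _ => none) (hH : κ.H = fun _ => none) :
    ∃ κ' σ' r', Exhaustive 𝕊 κ κ' ∧ κ'.U = (fun _ => none) ∧ (κ'.H = fun _ => none) ∧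
      Models 𝕊 G κ' σ' r' := by
  -- Termination comes from the size of the derivation.
  induction hn : r.2.2 using Nat.strong_induction_on generalizing κ σ r with
  | _ n ih =>
    subst hn
    by_cases hex : ∃ κ₁, Step 𝕊 κ κ₁
    · obtain ⟨κ₁, h₁⟩ := hex
      obtain ⟨κ₂, σ₂, r₂, h₂, hU₂, hH₂, hm, hlt⟩ := h.descends_of_step h₁ hU hH
      obtain ⟨κ', σ', r', h', rest⟩ := ih _ hlt hm hU₂ hH₂ rfl
      exact ⟨κ', σ', r', ⟨.head h₂ h'.1, h'.2⟩, rest⟩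
    · exact ⟨κ, σ, r, ⟨.refl, hex⟩, hU, hH, h⟩

theorem not_satAll_fls {cs : Multiset (Constraint S Var Empty)} :
    ¬ SatAll 𝕊 G (.fls ::ₘ cs) r := by
  rw [satAll_cons_iff_unfold]
  rintro ⟨_, _, _, hu, -⟩
  cases hu

end

/-! ## Untouched variables -/

/-- The substitution fixes `x` and does not introduce it elsewhere. -/
def Subst.Untouched (θ : Subst S) (x : Var) : Prop :=
  θ x = .var x ∧ ∀ z, (θ z).Occurs x → z = x

namespace Subst.Untouched

variable {θ θ₁ θ₂ : Subst S} {x : Var}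

theorem comp (h₁ : Untouched θ₁ x) (h₂ : Untouched θ₂ x) : Untouched (θ₁.comp θ₂) x := by
  refine ⟨by simp [Subst.comp, h₁.1, Term.bind, h₂.1], fun z hz => ?_⟩
  obtain ⟨y, hy, hx⟩ := (Term.occurs_bind_iff _ _ _).1 hz
  exact h₁.2 z (h₂.2 y hx ▸ hy)

theorem var : Untouched (S := S) Term.var x := ⟨rfl, fun _ h => h⟩

theorem occurs_of_bind (h : Untouched θ x) {t : Term S Var} (ht : (t.bind θ).Occurs x) :
    t.Occurs x := by
  obtain ⟨y, hy, hx⟩ := (Term.occurs_bind_iff _ _ _).1 ht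
  exact h.2 y hx ▸ hy

theorem one {s : Scope} {y : Var} (h : x ≠ y) : Untouched (Subst.one (S := S) y (.scope s)) x := by
  refine ⟨by simp [Subst.one, h], fun z hz => ?_⟩
  by_cases hy : z = y
  · simp [Subst.one, hy, Term.Occurs] at hz
  · simpa [Subst.one, hy, Term.Occurs] using hz

theorem eqConstraint_occurs_of_bind (h : Untouched θ x) {E : EqConstraint S Var}
    (hE : (E.bind θ).Occurs x) : E.Occurs x := by
  obtain ⟨y, hy, hx⟩ := EqConstraint.exists_occurs_of_occurs_bind _ _ _ hE
  exact h.2 y hx ▸ hy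

end Subst.Untouched

theorem map_bind_update_of_not_occurs (θ : Subst S) {x : Var} (t : Term S Var)
    {ts : List (Term S Var)} (h : ∀ u ∈ ts, ¬ u.Occurs x) :
    (ts.map fun u => u.bind (Function.update θ x t)) = ts.map fun u => u.bind θ := by
  refine List.map_congr_left fun u hu => (Term.bind_eq_bind_iff _ _ _).2 fun y hy => ?_
  rw [Function.update_of_ne]
  rintro rfl
  exact h u hu hy

/-- If `x` is not in the equations, redirecting `θ` at `x` to an arbitrary term gives another
unifier, which must factor through `θ`. Comparing the two choices `scope 0` and `scope 1` shows that
`θ` neither moves `x` nor introduces it elsewhere. -/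
theorem IsMGU.untouched {θ : Subst S} {ts us : List (Term S Var)} (h : IsMGU θ ts us) {x : Var}
    (hts : ∀ t ∈ ts, ¬ t.Occurs x) (hus : ∀ t ∈ us, ¬ t.Occurs x) : θ.Untouched x := by
  have key (n : Scope) (z : Var) : (θ z).bind (Function.update θ x (.scope n)) =
      Function.update θ x (.scope n) z := by
    refine congrFun (h.2 (Function.update θ x (.scope n)) ?_) z
    rw [Unifies, map_bind_update_of_not_occurs _ _ hts, map_bind_update_of_not_occurs _ _ hus]
    exact h.1
  have hne (z : Var) (hz : z ≠ x) : ¬ (θ z).Occurs x := fun ho => by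
    have e : (θ z).bind (Function.update θ x (.scope 0)) =
        (θ z).bind (Function.update θ x (.scope 1)) := by
      rw [key, key, Function.update_of_ne hz, Function.update_of_ne hz]
    simpa using (Term.bind_eq_bind_iff _ _ _).1 e x ho
  refine ⟨?_, fun z hz => by_contra fun hzx => hne z hzx hz⟩
  have h₀ := key 0 x
  have h₁ := key 1 x
  rw [Function.update_self] at h₀ h₁
  cases hx : θ x with
  | var y =>
    by_cases hy : y = x
    · rw [hy]
    · simp only [hx, Term.bind, Function.update_of_ne hy] at h₀ h₁
      simp [h₀] at h₁
  | app f n args => simp [hx, Term.bind] at h₀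
  | lbl l => simp [hx, Term.bind] at h₀
  | scope s =>
    simp only [hx, Term.bind, Term.scope.injEq] at h₀ h₁
    exact absurd (h₀.symm.trans h₁) zero_ne_one

theorem IsMGU.comp_self {θ : Subst S} {ts us : List (Term S Var)} (h : IsMGU θ ts us) :
    θ.comp θ = θ := h.2 θ h.1

/-- Membership of `x` in the set of used variables is carried along because it prevents an opened
existential from choosing `x`. -/
theorem Produces.untouched {X X' : Set Var} {G : Graph S} {E : EqConstraint S Var}
    {θ : Subst S} (h : Produces X G E θ X') {x : Var} :
    x ∈ X → ¬ E.Occurs x → (∀ s t, G.data s = some t → ¬ t.Occurs x) →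
      θ.Untouched x ∧ x ∈ X' := by
  induction h with
  | eq X G t₁ t₂ θ hθ =>
    intro hx hE _
    refine ⟨hθ.untouched ?_ ?_, hx⟩ <;> simp only [List.mem_singleton, forall_eq]
    · exact fun h => hE (.inl h)
    · exact fun h => hE (.inr h)
  | dataOf X G s d t θ hd hθ =>
    intro hx hE hG
    refine ⟨hθ.untouched ?_ ?_, hx⟩ <;> simp only [List.mem_singleton, forall_eq]
    · exact hG s d hd
    · exact fun h => hE (.inr h)
  | conj X X₁ X₂ G E₁ E₂ θ₁ θ₂ _ _ ih₁ ih₂ =>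
    intro hx hE hG
    obtain ⟨h₁, hx₁⟩ := ih₁ hx (fun h => hE (.inl h)) hG
    obtain ⟨h₂, hx₂⟩ := ih₂ hx₁ (fun h => hE (.inr (h₁.eqConstraint_occurs_of_bind h)))
      fun s t ht h => by
        obtain ⟨t, hs, rfl⟩ := Option.map_eq_some_iff.1 ht
        exact hG s t hs (h₁.occurs_of_bind h)
    exact ⟨h₁.comp h₂, hx₂⟩
  | ex X X' G E y θ hy _ ih =>
    intro hx hE hG
    refine ih (Set.mem_insert_of_mem _ hx) (fun h => ?_) hG
    rcases EqConstraint.occurs_inst h with h | h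
    · exact hE h
    · cases h
      exact hy hx

/-! ## Transitions -/

/-- Only nodes of the graph carry data. -/
def Graph.WF (G : Graph S) : Prop := ∀ s t, G.data s = some t → s ∈ G.nodes

/-- The variable occurs in the scope graph or in a constraint. -/
def Config.Active (κ : Config S) (x : Var) : Prop :=
  (∃ s t, κ.graph.data s = some t ∧ t.Occurs x) ∨ ∃ C ∈ κ.cs, C.Occurs x

/-- `κ'` arises from `κ` under the substitution `θ`, so that models of `κ'` yield models of
`κ`, hole states are instantiated by `θ`, and inactive hole variables remain unaffected. -/
structure Transition (𝕊 : Spec S) (κ : Config S) (θ : Subst S) (κ' : Config S) : Prop where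
  wf : κ.graph.WF → κ'.graph.WF
  models : κ.graph.WF → ∀ G σ r, Models 𝕊 G κ' σ r → ∃ r', Models 𝕊 G κ (θ.comp σ) r'
  used : ∀ x, κ.U x ≠ none → κ'.U x ≠ none
  holes : ∀ h, (κ'.H h).map Prod.snd = (κ.H h).map fun p => p.2.bind θ
  inactive : ∀ x, κ.U x ≠ none → ¬ κ.Active x → θ x = .var x ∧ ¬ κ'.Active x

theorem comp_var (θ : Subst S) : θ.comp Term.var = θ := by
  funext x
  exact Term.bind_var _

theorem comp_assoc (θ₁ θ₂ θ₃ : Subst S) :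
    (θ₁.comp θ₂).comp θ₃ = θ₁.comp (θ₂.comp θ₃) := by
  funext x
  exact Term.bind_bind _ _ _

theorem Config.substTo_var (κ : Config S) : κ.SubstTo Term.var κ := by
  refine ⟨?_, ?_, ⟨fun x h hx => ⟨hx, fun y hy => ?_⟩, fun y h hy => .inl hy⟩, ?_⟩
  · obtain ⟨⟨_, _, _⟩, _⟩ := κ
    simp [Graph.subst, Term.bind_var]
  · simp [Constraint.bind_var]
  · cases hy
    exact hx
  · funext h
    simp [HoleState.subst, Term.bind_var]

namespace Transition

variable {κ κ' κ'' : Config S} {θ θ' : Subst S}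

theorem refl (κ : Config S) : Transition 𝕊 κ Term.var κ where
  wf h := h
  models _ _ _ r h := ⟨r, h⟩
  used _ h := h
  holes h := by simp [Term.bind_var]
  inactive _ _ h := ⟨rfl, h⟩

theorem trans (h₁ : Transition 𝕊 κ θ κ') (h₂ : Transition 𝕊 κ' θ' κ'') :
    Transition 𝕊 κ (θ.comp θ') κ'' where
  wf h := h₂.wf (h₁.wf h)
  models h G σ r hm := by
    obtain ⟨r', hm'⟩ := h₂.models (h₁.wf h) G σ r hm
    rw [comp_assoc]
    exact h₁.models h G _ r' hm'
  used x h := h₂.used x (h₁.used x h)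
  holes h := by
    have e := congrArg (Option.map fun t => t.bind θ') (h₁.holes h)
    rw [Option.map_map, Option.map_map] at e
    rw [h₂.holes]
    refine e.trans ?_
    congr 1
    funext p
    exact Term.bind_bind _ _ _
  inactive x hx hn := by
    obtain ⟨e, hn'⟩ := h₁.inactive x hx hn
    obtain ⟨e', hn''⟩ := h₂.inactive x (h₁.used x hx) hn'
    exact ⟨by simp [Subst.comp, e, Term.bind, e'], hn''⟩

end Transition

theorem Config.SubstTo.exists_active {κ κ' : Config S} {θ : Subst S} (h : κ.SubstTo θ κ')
    {x : Var} (hx : κ'.Active x) : ∃ y, κ.Active y ∧ (θ y).Occurs x := by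
  obtain ⟨hg, hc, -, -⟩ := h
  rcases hx with ⟨s, t, hs, ht⟩ | ⟨C, hC, hx⟩
  · rw [hg] at hs
    obtain ⟨t, hs', rfl⟩ := Option.map_eq_some_iff.1 hs
    exact ((Term.occurs_bind_iff _ _ _).1 ht).imp fun y hy => ⟨.inl ⟨s, t, hs', hy.1⟩, hy.2⟩
  · rw [hc] at hC
    obtain ⟨C, hC', rfl⟩ := Multiset.mem_map.1 hC
    exact (Constraint.exists_occurs_of_occurs_bind _ _ _ hx).imp
      fun y hy => ⟨.inr ⟨C, hC', hy.1⟩, hy.2⟩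

/-- An idempotent substitution fixes every variable occurring in its values, and every active
variable of `κ'` occurs in some value `θ y`. So an instantiated variable disappears. -/
theorem Config.SubstTo.eq_var_or_not_active {κ κ' : Config S} {θ : Subst S}
    (h : κ.SubstTo θ κ') (hθ : θ.comp θ = θ) (x : Var) : θ x = .var x ∨ ¬ κ'.Active x := by
  refine or_iff_not_imp_right.2 fun hx => ?_
  obtain ⟨y, -, hy⟩ := h.exists_active (not_not.1 hx)
  have e : (θ y).bind θ = (θ y).bind Term.var := (congrFun hθ y).trans (Term.bind_var _).symm
  exact (Term.bind_eq_bind_iff _ _ _).1 e x hy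

/-- Splits a step into a rewriting of `κ` to `κ₁` followed by the substitution `θ`, so that each
rule has to treat only its rewriting. Scope lists in the hole states may differ, because only the
terms matter here. -/
theorem Config.SubstTo.transition {κ κ₁ κ' : Config S} {θ : Subst S} (h : κ₁.SubstTo θ κ')
    (hwf : κ.graph.WF → κ₁.graph.WF)
    (hm : κ.graph.WF → ∀ G σ r, Models 𝕊 G κ₁ (θ.comp σ) r → ∃ r', Models 𝕊 G κ (θ.comp σ) r')
    (hU : κ₁.U = κ.U) (hH : ∀ h, (κ₁.H h).map Prod.snd = (κ.H h).map Prod.snd)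
    (hx : ∀ x, κ.U x ≠ none → ¬ κ.Active x → θ.Untouched x ∧ ¬ κ₁.Active x) :
    Transition 𝕊 κ θ κ' where
  wf hκ s t hs := by
    rw [h.1] at hs ⊢
    obtain ⟨t, hs', rfl⟩ := Option.map_eq_some_iff.1 hs
    exact hwf hκ s t hs'
  models hκ G σ r hr := hm hκ G σ r ((models_iff_of_substTo h).1 hr)
  used x hx := by
    obtain ⟨i, hi⟩ := Option.ne_none_iff_exists'.1 hx
    rw [(h.2.2.1.1 x i (hU ▸ hi)).1]
    simp
  holes i := by
    have e := congrArg (Option.map fun t => t.bind θ) (hH i)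
    rw [h.2.2.2]
    simpa [HoleState.subst, Function.comp_def] using e
  inactive x hu hn := by
    obtain ⟨hθ, hn'⟩ := hx x hu hn
    refine ⟨hθ.1, fun ha => ?_⟩
    obtain ⟨y, hy, hy'⟩ := h.exists_active ha
    exact hn' (hθ.2 y hy' ▸ hy)

/-- If a constraint unfolds to others, then a model of these is a model of the constraint. -/
theorem Models.fold {G G₀ : Graph S} {C : Constraint S Var Empty}
    {cs' cs cs₁ : Multiset (Constraint S Var Empty)} {U : HoleMap} {H : HoleState S}
    {σ : Subst S} {r : Resources S} (h : Models 𝕊 G ⟨G₀, cs₁, U, H⟩ σ r) (hcs : cs₁ = cs' + cs)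
    (hu : Unfold 𝕊 G (C.bind σ) (cs'.map fun C => C.bind σ) .tick) :
    ∃ r', Models 𝕊 G ⟨G₀, C ::ₘ cs, U, H⟩ σ r' := by
  subst hcs
  refine ⟨.tick + r, h.replace ?_ ?_ ?_ fun _ _ _ _ _ => rfl⟩ <;> try simp [Resources.tick]
  rw [satAll_cons_iff_unfold]
  exact ⟨_, _, _, hu, by simpa using h.sat, rfl⟩

/-- Each rule is an inference read from premises to conclusion. The extra alternative, that a hole
variable is fixed or no longer active, detects instantiations made before hole states exist. -/
theorem Step.exists_transition {κ κ' : Config S} (h : Step 𝕊 κ κ') :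
    ∃ θ, Transition 𝕊 κ θ κ' ∧ ∀ x, κ.U x ≠ none → θ x = .var x ∨ ¬ κ'.Active x := by
  -- The rules that substitute nothing are transitions under the identity.
  have keep : ∀ {κ' : Config S}, (κ.graph.WF → κ'.graph.WF) →
      (∀ G σ r, Models 𝕊 G κ' σ r → ∃ r', Models 𝕊 G κ σ r') → κ'.U = κ.U → κ'.H = κ.H →
      κ'.graph.data = κ.graph.data →
      (∀ x, κ.U x ≠ none → ∀ C ∈ κ'.cs, C.Occurs x → κ.Active x) →
      ∃ θ, Transition 𝕊 κ θ κ' ∧ ∀ x, κ.U x ≠ none → θ x = .var x ∨ ¬ κ'.Active x := by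
    intro κ' hwf hm hU hH hd hx
    refine ⟨Term.var, κ'.substTo_var.transition hwf (fun _ G σ r => hm G _ r) hU
      (fun h => by rw [hH]) fun x hu hn => ⟨.var, ?_⟩, fun _ _ => .inl rfl⟩
    rintro (⟨s, t, hs, ht⟩ | ⟨C, hC, ho⟩)
    · exact hn (.inl ⟨s, t, hd ▸ hs, ht⟩)
    · exact hn (hx x hu C hC ho)
  cases h with
  | conj G C₁ C₂ cs U H =>
    refine keep id (fun G σ r hm => hm.fold (cs' := {C₁, C₂}) (by simp) ?_) rfl rfl rfl
      fun x _ C hC ho => ?_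
    · simpa [Constraint.bind] using Unfold.conj (C₁.bind σ) (C₂.bind σ)
    · rcases Multiset.mem_cons.1 hC with rfl | hC
      · exact .inr ⟨_, Multiset.mem_cons_self _ _, .inl ho⟩
      rcases Multiset.mem_cons.1 hC with rfl | hC
      · exact .inr ⟨_, Multiset.mem_cons_self _ _, .inr ho⟩
      · exact .inr ⟨C, Multiset.mem_cons_of_mem hC, ho⟩
  | emp G cs U H =>
    exact keep id (fun G σ r hm => hm.fold (cs' := 0) (by simp) .emp) rfl rfl rfl
      fun x _ C hC ho => .inr ⟨C, Multiset.mem_cons_of_mem hC, ho⟩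
  | ex G C cs U H y hy =>
    refine keep id (fun G σ r hm => hm.fold (cs' := {C.inst (.var y)}) (by simp) ?_) rfl rfl rfl
      fun x hu C' hC ho => ?_
    · simpa [Constraint.bind, Term.bind, Constraint.inst_bind] using
        Unfold.ex (C.bind (liftSubst σ)) (σ y)
    · rcases Multiset.mem_cons.1 hC with rfl | hC
      · rcases Constraint.occurs_inst ho with ho | ho
        · exact .inr ⟨_, Multiset.mem_cons_self _ _, ho⟩
        · cases ho
          exact (hy (.inr (.inr (.inl hu)))).elim
      · exact .inr ⟨C', Multiset.mem_cons_of_mem hC, ho⟩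
  | eq G t₁ t₂ cs U H θ _ hθ hκ =>
    refine ⟨θ, hκ.transition id (fun _ G σ r hm => hm.fold (cs' := 0) (by simp) ?_) rfl
      (fun _ => rfl) fun x _ hn => ⟨hθ.untouched ?_ ?_, ?_⟩,
      fun x _ => hκ.eq_var_or_not_active hθ.comp_self x⟩
    · have e : t₁.bind (θ.comp σ) = t₂.bind (θ.comp σ) := by
        have := congrArg (fun ts => ts.map fun t => Term.bind t σ) hθ.1
        simp only [List.map_cons, List.map_nil, Term.bind_bind, List.cons.injEq, and_true] at this
        exact this
      simpa [Constraint.bind, e] using Unfold.eq (t₂.bind (θ.comp σ))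
    · simp only [List.mem_singleton, forall_eq]
      exact fun ho => hn (.inr ⟨_, Multiset.mem_cons_self _ _, .inl ho⟩)
    · simp only [List.mem_singleton, forall_eq]
      exact fun ho => hn (.inr ⟨_, Multiset.mem_cons_self _ _, .inr ho⟩)
    · exact fun ha => hn (ha.imp_right fun ⟨C, hC, ho⟩ => ⟨C, Multiset.mem_cons_of_mem hC, ho⟩)
  | single G t t' cs U H =>
    refine keep id (fun G σ r hm => hm.fold (cs' := {.eq t t'}) (by simp) ?_) rfl rfl rfl
      fun x _ C hC ho => ?_
    · exact Unfold.single (t.bind σ) (t'.bind σ)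
    · rcases Multiset.mem_cons.1 hC with rfl | hC
      · exact .inr ⟨_, Multiset.mem_cons_self _ _, ho.imp_right fun h =>
          ⟨t', Multiset.mem_singleton_self _, h⟩⟩
      · exact .inr ⟨C, Multiset.mem_cons_of_mem hC, ho⟩
  | all G ζ C cs U H =>
    refine keep id (fun G σ r hm => hm.fold (cs' := ζ.map fun t => C.inst t) rfl ?_) rfl rfl rfl
      fun x _ C' hC ho => ?_
    · simpa [Constraint.bind, SetTerm.bind, Function.comp_def, Constraint.inst_bind] using
        Unfold.all (ζ.map fun t => t.bind σ) (C.bind (liftSubst σ))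
    · rcases Multiset.mem_add.1 hC with hC | hC
      · obtain ⟨t, ht, rfl⟩ := Multiset.mem_map.1 hC
        refine .inr ⟨_, Multiset.mem_cons_self _ _, ?_⟩
        exact (Constraint.occurs_inst ho).elim .inr fun h => .inl ⟨t, ht, h⟩
      · exact .inr ⟨C', Multiset.mem_cons_of_mem hC, ho⟩
  | newScope G x t cs U H s _ hs hκ =>
    have hid : Subst.comp (Subst.one (S := S) x (.scope s)) (Subst.one x (.scope s)) =
        Subst.one x (.scope s) := by
      funext y
      by_cases hy : y = x <;> simp [Subst.comp, Subst.one, hy, Term.bind]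
    refine ⟨Subst.one x (.scope s), hκ.transition (fun h s' t' hs' => ?_) ?_ rfl (fun _ => rfl)
      fun y _ hn => ⟨.one ?_, ?_⟩, fun y _ => hκ.eq_var_or_not_active hid y⟩
    · by_cases h' : s' = s
      · exact .inl h'
      · simp only [Graph.addNode, Function.update_of_ne h'] at hs'
        exact .inr (h s' t' hs')
    · intro hwf G' σ r hm
      obtain ⟨h₁, h₂, h₃, h₄, h₅⟩ := hm
      have hsr : s ∉ r.1 := fun h => h₃ s h (.inl rfl)
      refine ⟨({s}, 0, 1) + r, ?_, ?_, ?_, ?_, ?_⟩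
      · rw [Multiset.map_cons, satAll_cons_iff_unfold]
        refine ⟨0, _, r, ?_, by simpa using h₁, rfl⟩
        have := Unfold.new (𝕊 := 𝕊) s _ (h₅ s t (by simp [Graph.addNode]))
        simpa [Constraint.bind, Term.bind, Subst.comp, Subst.one] using this
      · simp [h₂, hsr]
      · intro s' hs'
        rcases Multiset.mem_add.1 hs' with h | h
        · rwa [Multiset.mem_singleton.1 h]
        · exact fun h' => h₃ s' h (.inr h')
      · intro e
        simpa [Graph.addNode] using h₄ e
      · intro s' t' hs'
        refine h₅ s' t' ?_
        -- Data sits on nodes only, so the new node overwrites no existing data; this is where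
        -- `Graph.WF` is needed.
        have : s' ≠ s := fun e => hs (e ▸ hwf s' t' hs')
        simp only [Graph.addNode, Function.update_of_ne this]
        exact hs'
    · rintro rfl
      exact hn (.inr ⟨_, Multiset.mem_cons_self _ _, .inl rfl⟩)
    · rintro (⟨s', t', hs', ht⟩ | ⟨C, hC, ho⟩)
      · by_cases h' : s' = s
        · subst h'
          simp only [Graph.addNode, Function.update_self, Option.some.injEq] at hs'
          subst hs'
          exact hn (.inr ⟨_, Multiset.mem_cons_self _ _, .inr ht⟩)
        · simp only [Graph.addNode, Function.update_of_ne h'] at hs'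
          exact hn (.inl ⟨s', t', hs', ht⟩)
      · exact hn (.inr ⟨C, Multiset.mem_cons_of_mem hC, ho⟩)
  | newEdge G s₁ l s₂ cs U H =>
    refine keep id (fun G' σ r hm => ?_) rfl rfl rfl
      fun x _ C hC ho => .inr ⟨C, Multiset.mem_cons_of_mem hC, ho⟩
    obtain ⟨h₁, h₂, h₃, h₄, h₅⟩ := hm
    refine ⟨(0, {(s₁, l, s₂)}, 1) + r, ?_, by simpa using h₂,
      by simpa [Graph.addEdge] using h₃, ?_, h₅⟩
    · rw [Multiset.map_cons, satAll_cons_iff_unfold]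
      exact ⟨0, _, r, .edge s₁ l s₂, by simpa using h₁, rfl⟩
    · intro e
      rw [h₄]
      simp [Graph.addEdge]
      tauto
  | data G s t₁ t₂ cs U H hd =>
    refine keep id (fun G σ r hm => hm.fold (cs' := {.eq t₁ t₂}) (by simp) ?_) rfl rfl rfl
      fun x _ C hC ho => ?_
    · exact Unfold.dataOf s (t₁.bind σ) (t₂.bind σ) (hm.data s t₂ hd)
    · rcases Multiset.mem_cons.1 hC with rfl | hC
      · rcases ho with ho | ho
        · exact .inr ⟨_, Multiset.mem_cons_self _ _, .inr ho⟩
        · exact .inl ⟨s, t₂, hd, ho⟩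
      · exact .inr ⟨C, Multiset.mem_cons_of_mem hC, ho⟩
  | query G o s q E C cs U H A ζ hE hA hg hn hζ =>
    have hgr (σ : Subst S) : ζ.map (fun t => t.bind σ) = ζ := by
      conv_rhs => rw [← Multiset.map_id ζ]
      refine Multiset.map_congr rfl fun t ht => ?_
      obtain ⟨p, -, rfl⟩ := (hζ t).1 ht
      exact (isGround_pathTerm s p).bind_eq σ
    refine keep id (fun G σ r hm => hm.fold (cs' := {C.instSet ζ}) (by simp) ?_) rfl rfl rfl
      fun x _ C' hC ho => ?_
    -- The guard is checked in the present graph, while the inference needs the answer in the final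
    -- one.
    · have hv := mem_visiblePaths_iff_of_guard hA hg (ζ := ζ)
        (by simpa [Constraint.instSet_bind, hgr] using hm.sat) hm.fresh hm.edges hm.data
      have := Unfold.query (𝕊 := 𝕊) (G := G) o s q (E.bind (liftSubst σ)) (C.bind σ) ζ hn
        fun t => by simp only [hζ, hv]
      simpa [Constraint.bind, Term.bind, Constraint.instSet_bind, hgr] using this
    · rcases Multiset.mem_cons.1 hC with rfl | hC
      · rcases Constraint.occurs_instSet ho with ho | ⟨t, ht, ho⟩
        · exact .inr ⟨_, Multiset.mem_cons_self _ _, .inr (.inr ho)⟩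
        · obtain ⟨p, -, rfl⟩ := (hζ t).1 ht
          exact (isGround_pathTerm s p x ho).elim
      · exact .inr ⟨C', Multiset.mem_cons_of_mem hC, ho⟩
  | pred G P ts cs U H R v θ _ hR hP huniq hv hfresh hθ hκ =>
    have hused : ∀ x, U x ≠ none → ∀ i, x ≠ v i := by
      rintro x hu i rfl
      exact hfresh i (.inr (.inr (.inl hu)))
    refine ⟨θ, hκ.transition id (fun _ G σ r hm =>
      hm.fold (cs' := {R.body.bind fun i => .var (v i)}) (by simp) ?_) rfl
      (fun _ => rfl) fun x hu hn => ⟨hθ.untouched ?_ ?_, ?_⟩,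
      fun x _ => hκ.eq_var_or_not_active hθ.comp_self x⟩
    · have e := congrArg (fun ts => ts.map fun t => Term.bind t σ) hθ.1
      simp only [List.map_map, Function.comp_def, Term.bind_bind, Term.map, Term.bind] at e
      have := Unfold.pred (𝕊 := 𝕊) (G := G) R (fun i => (θ.comp σ) (v i)) hR
      subst hP
      simp only [Constraint.bind, Multiset.map_singleton, Constraint.bind_bind, Term.bind]
      refine Eq.subst (motive := fun us => Unfold 𝕊 G (.pred R.pred us) _ _) ?_ this
      exact e.symm
    · exact fun t ht ho => hn (.inr ⟨_, Multiset.mem_cons_self _ _, t, ht, ho⟩)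
    · intro t ht ho
      obtain ⟨t, -, rfl⟩ := List.mem_map.1 ht
      obtain ⟨i, -, hi⟩ := (Term.occurs_bind_iff _ _ _).1 ho
      exact hused x hu i hi.symm
    · rintro (ha | ⟨C, hC, ho⟩)
      · exact hn (.inl ha)
      · rcases Multiset.mem_cons.1 hC with rfl | hC
        · obtain ⟨i, -, hi⟩ := Constraint.exists_occurs_of_occurs_bind _ _ _ ho
          exact hused x hu i hi.symm
        · exact hn (.inr ⟨C, Multiset.mem_cons_of_mem hC, ho⟩)
  | eqFail | singleFail | predFail | falseFail =>
    exact keep id (fun G σ r hm => (not_satAll_fls (cs := 0) hm.sat).elim) rfl rfl rfl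
      fun x _ C hC ho => by rw [Multiset.mem_singleton.1 hC] at ho; exact ho.elim

/-- An expansion only instantiates and removes no constraint, so soundness does not depend on how
`θ` was guessed. What must be checked is that inactive hole variables stay untouched and that hole
terms change only by `θ`. -/
theorem Expand.transition {κ κ' : Config S} {θ : Subst S} {H' : HoleState S}
    (h : Expand 𝕊 κ θ H') (hs : Config.SubstTo { κ with H := H' } θ κ') :
    Transition 𝕊 κ θ κ' := by
  refine hs.transition id (fun _ G σ r hm => ⟨r, hm.1, hm.2, hm.3, hm.4, hm.5⟩) rfl ?_ ?_
  · cases h with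
    | pred => exact fun _ => rfl
    | query G o t q E C cs U H x h sₜ ss t' s' s'' θ₁ θ₂ X' A p hx hU hH =>
      intro i
      by_cases hi : i = h
      · simp [hi, hH]
      · simp [hi]
  · intro x hu hn
    refine ⟨?_, hn⟩
    cases h with
    | pred G P ts cs U H R v θ hR hP hv hfresh hθ =>
      refine hθ.untouched
        (fun t ht ho => hn (.inr ⟨_, Multiset.mem_cons_self _ _, t, ht, ho⟩)) fun t ht ho => ?_
      obtain ⟨t, -, rfl⟩ := List.mem_map.1 ht
      obtain ⟨i, -, rfl⟩ := (Term.occurs_bind_iff _ _ _).1 ho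
      exact hfresh i (.inr (.inr (.inl hu)))
    | query G o t q E C cs U H y h sₜ ss t' s' s'' θ₁ θ₂ X' A p hx hU hH hs' hs'' hθ₁ _ hpr =>
      have h₁ : θ₁.Untouched x := by
        refine hθ₁.untouched ?_ ?_ <;> simp only [List.mem_singleton, forall_eq]
        · exact fun ho => hn (.inr ⟨_, Multiset.mem_cons_self _ _, .inl ho⟩)
        · exact id
      refine h₁.comp (hpr.untouched (.inr (.inr (.inl hu))) (fun ho => ?_)
        fun s t hst ho => hn (.inl ⟨s, t, hst, ho⟩)).1
      rcases EqConstraint.occurs_inst (h₁.eqConstraint_occurs_of_bind ho) with ho | ho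
      · exact hn (.inr ⟨_, Multiset.mem_cons_self _ _, .inr (.inl ho)⟩)
      · exact ho

/-! ### Composition of transitions along runs -/

theorem exists_transition_of_reflTransGen_step {κ κ' : Config S}
    (h : Relation.ReflTransGen (Step 𝕊) κ κ') :
    ∃ θ, Transition 𝕊 κ θ κ' ∧ ∀ x, κ.U x ≠ none → θ x = .var x ∨ ¬ κ'.Active x := by
  induction h with
  | refl => exact ⟨_, .refl κ, fun _ _ => .inl rfl⟩
  | tail _ hstep ih =>
    obtain ⟨θ, ht, hx⟩ := ih
    obtain ⟨θ', ht', hx'⟩ := hstep.exists_transition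
    -- A variable not moved so far is handled by the last step; one that has become inactive stays
    -- inactive.
    refine ⟨_, ht.trans ht', fun x hu => ?_⟩
    rcases hx x hu with e | hn
    · simpa [Subst.comp, e, Term.bind] using hx' x (ht.used x hu)
    · exact .inr (ht'.inactive x (ht.used x hu) hn).2

theorem exists_transition_of_reflTransGen_synthStep {κ : Config S} {K : Set (Config S)}
    (h : Relation.ReflTransGen (SynthStep 𝕊) {κ} K) :
    ∀ κ' ∈ K, ∃ θ, Transition 𝕊 κ θ κ' := by
  induction h with
  | refl =>
    rintro _ rfl
    exact ⟨_, .refl _⟩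
  | tail _ hstep ih =>
    cases hstep with
    | solve κ₁ κ₂ K hs =>
      rintro κ' (rfl | hκ')
      · obtain ⟨θ, ht⟩ := ih κ₁ (.inl rfl)
        obtain ⟨θ', ht', -⟩ := hs.exists_transition
        exact ⟨_, ht.trans ht'⟩
      · exact ih κ' (.inr hκ')
    | expand κ₁ K =>
      rintro κ' (⟨θ', H', he, hs⟩ | hκ')
      · obtain ⟨θ, ht⟩ := ih κ₁ (.inl rfl)
        exact ⟨_, ht.trans (he.transition hs)⟩
      · exact ih κ' (.inr hκ')

end Statix

/-! ### Soundness of synthesis -/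

theorem mainTheorem1 (S : Statix.Signature) (𝕊 : Statix.Spec S) (P₀ : S.Pred)
    (P : Statix.LockedProgram S) (P' : Statix.Term S Statix.Var)
    (hinit : 𝕊.Init P₀) (hsyn : Statix.Synthesizes 𝕊 P₀ P P') (hground : P'.IsGround) :
    ∃ G : Statix.Graph S,
      Statix.Exhaustive 𝕊 (Statix.Config.initial P₀ P' (fun _ => none))
        ⟨G, 0, fun _ => none, fun _ => none⟩ := by
  open Statix in
  obtain ⟨Q, D, U, G₀, cs, H, K, κ, -, -, hU, -, hrun, hH, hsyn, hκ, hacc, hP'⟩ := hsyn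
  obtain ⟨θ₁, ht₁, hx₁⟩ := exists_transition_of_reflTransGen_step hrun
  obtain ⟨θ₂, ht₂⟩ := exists_transition_of_reflTransGen_synthStep hsyn κ hκ
  -- The state of the hole of `x` starts with the term `x`, so it ends with `θ₂ x`. A missing state,
  -- or an elimination of `x` in the initial phase, would leave `x` in the ground program `P'`.
  have hres : ∀ x, Q.Occurs x → resultSubst U κ.H x = θ₂ x ∧ θ₁ x = .var x := by
    intro x hx
    have hxg : resultSubst U κ.H x ≠ .var x := fun e =>
      hground x (hP' ▸ (Term.occurs_bind_iff _ _ _).2 ⟨x, hx, by rw [e]; rfl⟩)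
    obtain ⟨h, hxh⟩ := Option.ne_none_iff_exists'.1 ((hU x).2 hx)
    have e : resultSubst U κ.H x = θ₂ x := by
      have hh := ht₂.holes h
      rcases hH.1 x h hxh with ⟨s, -, hs⟩ | ⟨-, hs⟩
      · simp only [hs, Option.map_some, Option.map_eq_some_iff] at hh
        obtain ⟨⟨l, t⟩, hl, rfl⟩ := hh
        simp [resultSubst, hxh, hl, Term.bind]
      · simp only [hs, Option.map_none, Option.map_eq_none_iff] at hh
        exact (hxg (by simp [resultSubst, hxh, hh])).elim
    refine ⟨e, (hx₁ x ((hU x).2 hx)).resolve_right fun hn => hxg ?_⟩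
    rw [e]
    exact (ht₂.inactive x ((hU x).2 hx) hn).1
  have hQ : (Q.bind (θ₁.comp θ₂)).bind Term.var = P'.bind Term.var := by
    rw [hP', Term.bind_var, Term.bind_var]
    refine (Term.bind_eq_bind_iff _ _ _).2 fun x hx => ?_
    rw [(hres x hx).1, Subst.comp, (hres x hx).2]
    rfl
  -- The graph of the accepting configuration is the final graph, and nothing remains to be derived.
  have hm : Models 𝕊 κ.graph κ Term.var 0 :=
    ⟨by rw [hacc.1]; exact .zero, by simp, by simp, by simp, fun s t h => by rwa [Term.bind_var]⟩
  have hwf : (Graph.empty (S := S)).WF := fun _ _ h => by cases h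
  obtain ⟨r₁, hm₁⟩ := ht₂.models (ht₁.wf hwf) _ _ _ hm
  -- The two phases meet in configurations that differ only in the hole state, which models ignore.
  obtain ⟨r₂, hm₂⟩ := ht₁.models hwf _ _ r₁ ⟨hm₁.1, hm₁.2, hm₁.3, hm₁.4, hm₁.5⟩
  have hm₃ : Models 𝕊 κ.graph (Config.initial P₀ P' fun _ => none) Term.var r₂ := by
    refine hm₂.replace ?_ rfl rfl fun x s t h => by cases h
    have e := hm₂.sat
    rw [comp_var] at e
    rw [Term.bind_var] at hQ
    simpa [Config.initial, Constraint.bind, ← hQ] using e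
  obtain ⟨⟨G, cs', U', H'⟩, σ, r, hex, hU', hH', hm'⟩ := hm₃.exists_exhaustive rfl rfl
  dsimp only at hU' hH'
  subst hU' hH'
  rcases hinit P' _ hground hex with h | h
  · dsimp only at h
    subst h
    exact ⟨G, hex⟩
  · dsimp only at h
    subst h
    exact (not_satAll_fls (cs := 0) hm'.sat).elim
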